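/- A connectivity function on a finite set $U$ is a map $\kappa:2^U\to\mathbb N$ with $\kappa(\emptyset)=0$, $\kappa(X)=\kappa(\overline X)$ and $\kappa(X)+\kappa(Y)\ge\kappa(X\cap Y)+\kappa(X\cup Y)$ for all $X,Y\subseteq U$, where $\overline X=U\setminus X$. A $\kappa$-tangle of order $\ell\ge 0$ is a set $\mathcal T\subseteq 2^U$, annotated with $\ell$, such that: $\kappa(X)<\ell$ for all $X\in\mathcal T$; if $\kappa(X)<\ell$, then $X\in\mathcal T$ or $\overline X\in\mathcal T$; $X_1\cap X_2\cap X_3\ne\emptyset$ for all $X_1,X_2,X_3\in\mathcal T$; and $\mathcal T$ contains no singleton. The truncation of $\mathcal T$ to order $k\le\ell$ is $\{X\in\mathcal T\mid\kappa(X)<k\}$. A family $\mathfrak T$ of $\kappa$-tangles of order $k+1$ is coherent if all its members have the same truncation to order $k$. Tangles $\mathcal T,\mathcal T'$ are incomparable ($\mathcal T\bot\mathcal T'$) if neither contains the other. A $(\mathcal T,\mathcal T')$-separation is a set $Z\in\mathcal T$ with $\overline Z\in\mathcal T'$; it is minimum if $\kappa(Z)$ is minimum, and the leftmost minimum separation $Z(\mathcal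 T,\mathcal T')$ is the minimum one that is contained in all others. A comprehensive tangle data structure of order $K$ for $\kappa$ indexes all $\kappa$-tangles of order at most $K$ by $1,2,\dots$ and provides procedures that return $K$, the number of tangles of order at most $\ell$, whether a given set belongs to the $i$-th tangle, its order, the index of its truncation to a given order, the set $Z(\mathcal T_i,\mathcal T_j)$ for given $i\neq j$ (or the answer that it does not exist), and the index of a tangle given by its order and a membership oracle. A nested family for $\mathfrak T$ is a family $\mathcal N\subseteq 2^U$ that is closed under complementation, such that (i) for all $X,Y\in\mathcal N$ one of $X\subseteq Y$, $X\subseteq\overline Y$, $\overline X\subseteq Y$, $\overline X\subseteq\overline Y$ holds; (ii) for all $\mathcal T,\mathcal T'\in\mathfrak T$ with $\mathcal T\bot\mathcal T'$ some $Z\in\mathcal N$ is a minimum $(\mathcal T,\mathcal T')$-separation; (iii) every $Z\in\mathcal N$ is a minimum $(\mathcal T,\mathcal T')$-separation for some $\mathcal T,\mathcal T'\in\mathfrak T$ with $\mathcal T\bot\mathcal T'$. **Lemma.** Let $k\ge 0$. There is an algorithm, with running time polynomial in $|U|$, that, given a coherent family $\mathfrak T$ of $\kappa$-tangles of order $k+1$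 for a connectivity function $\kappa$ on a finite set $U$ (via oracle access to a comprehensive tangle data structure for $\kappa$ and the set of indices of the tangles in $\mathfrak T$), computes a canonical nested family $\mathcal N$ for $\mathfrak T$. Here canonical means: if $f:U_1\to U_2$ is a bijection with $\kappa_1(X)=\kappa_2(f(X))$ for all $X\subseteq U_1$ that maps $\mathfrak T_1$ to $\mathfrak T_2$, then it maps the family computed for $\mathfrak T_1$ to the family computed for $\mathfrak T_2$, whichever data structures and listings are used to present the two inputs. Moreover, $\mathcal N$ is built in layers. For a family $\mathfrak S$ of tangles, let $\mathcal Z(\mathfrak S)=\{Z(\mathcal T,\mathcal T')\mid\mathcal T,\mathcal T'\in\mathfrak S,\ \mathcal T\bot\mathcal T'\}$. Let $\mathcal N_0=\mathfrak T_0=\emptyset$, let $\mathcal N_{i+1}$ be the union of $\mathcal N_i$ with the set of all inclusion-minimal elements of $\mathcal Z(\mathfrak T\setminus\mathfrak T_i)$, and let $\mathfrak T_{i+1}$ be the set of all $\mathcal T\in\mathfrak T$ such that $Z(\mathcal T,\mathcal T')\in\mathcal N_{i+1}$ for some $\mathcal T'\in\mathfrak T$. Then $\mathcal N$ is the closure of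 $\bigcup_{i\ge 0}\mathcal N_i$ under complementation. -/

import Mathlib

universe u

/-! ### Connectivity functions and tangles -/

/-- A connectivity function on `U`: a symmetric submodular map `2^U → ℕ` that vanishes at `∅`. -/
structure ConnectivityFunction (U : Type*) where
  toFun : Set U → ℕ
  map_empty' : toFun ∅ = 0
  map_compl' : ∀ X, toFun Xᶜ = toFun X
  submodular' : ∀ X Y, toFun (X ∩ Y) + toFun (X ∪ Y) ≤ toFun X + toFun Y

instance {U : Type*} : CoeFun (ConnectivityFunction U) (fun _ => Set U → ℕ) :=
  ⟨ConnectivityFunction.toFun⟩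

/-- A `κ`-tangle, as a pair consisting of its order and its set of big sides. -/
@[ext]
structure Tangle {U : Type*} (κ : ConnectivityFunction U) where
  order : ℕ
  sets : Set (Set U)
  lt_order : ∀ X ∈ sets, κ X < order
  mem_or_compl_mem : ∀ X, κ X < order → X ∈ sets ∨ Xᶜ ∈ sets
  inter_nonempty : ∀ X₁ ∈ sets, ∀ X₂ ∈ sets, ∀ X₃ ∈ sets, (X₁ ∩ X₂ ∩ X₃).Nonempty
  singleton_notMem : ∀ a, {a} ∉ sets

namespace Tangle

variable {U : Type*} {κ : ConnectivityFunction U}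

/-- The truncation of a tangle to order `ℓ ≤ order` (and the tangle itself if `ℓ > order`). -/
def truncate (T : Tangle κ) (ℓ : ℕ) : Tangle κ where
  order := min ℓ T.order
  sets := {X ∈ T.sets | κ X < ℓ}
  lt_order X hX := lt_min hX.2 (T.lt_order X hX.1)
  mem_or_compl_mem X hX := by
    rcases T.mem_or_compl_mem X (lt_of_lt_of_le hX (min_le_right _ _)) with h | h
    · exact Or.inl ⟨h, lt_of_lt_of_le hX (min_le_left _ _)⟩
    · refine Or.inr ⟨h, ?_⟩
      rw [κ.map_compl']
      exact lt_of_lt_of_le hX (min_le_left _ _)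
  inter_nonempty X₁ h₁ X₂ h₂ X₃ h₃ := T.inter_nonempty X₁ h₁.1 X₂ h₂.1 X₃ h₃.1
  singleton_notMem a h := T.singleton_notMem a h.1

/-- Neither tangle is an extension of the other. -/
def Incomparable (T T' : Tangle κ) : Prop :=
  ¬ T.sets ⊆ T'.sets ∧ ¬ T'.sets ⊆ T.sets

/-- `Z` is a `(T, T')`-separation. -/
def IsSeparation (T T' : Tangle κ) (Z : Set U) : Prop :=
  Z ∈ T.sets ∧ Zᶜ ∈ T'.sets

/-- `Z` is a `(T, T')`-separation of minimum order. -/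
def IsMinSeparation (T T' : Tangle κ) (Z : Set U) : Prop :=
  IsSeparation T T' Z ∧ ∀ Z', IsSeparation T T' Z' → κ Z ≤ κ Z'

/-- `Z` is the leftmost minimum `(T, T')`-separation. -/
def IsLeftmostMinSeparation (T T' : Tangle κ) (Z : Set U) : Prop :=
  IsMinSeparation T T' Z ∧ ∀ Z', IsMinSeparation T T' Z' → Z ⊆ Z'

end Tangle

/-! ### Coherent families, nested families and layers -/

section Families

variable {U : Type*} {κ : ConnectivityFunction U}

/-- A coherent family of tangles of order `k + 1`: all have the same truncation to order `k`. -/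
def IsCoherent (k : ℕ) (F : Set (Tangle κ)) : Prop :=
  (∀ T ∈ F, T.order = k + 1) ∧ ∀ T ∈ F, ∀ T' ∈ F, T.truncate k = T'.truncate k

/-- The separations `X` and `Y` are nested, that is, they do not cross. -/
def SepNested (X Y : Set U) : Prop :=
  X ⊆ Y ∨ X ⊆ Yᶜ ∨ Xᶜ ⊆ Y ∨ Xᶜ ⊆ Yᶜ

/-- `N` is a nested family for the family `F` of tangles. -/
structure IsNestedFamilyFor (N : Set (Set U)) (F : Set (Tangle κ)) : Prop where
  nested : ∀ X ∈ N, ∀ Y ∈ N, SepNested X Y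
  compl_mem : ∀ X ∈ N, Xᶜ ∈ N
  separates : ∀ T ∈ F, ∀ T' ∈ F, T.Incomparable T' → ∃ Z ∈ N, T.IsMinSeparation T' Z
  needed : ∀ Z ∈ N, ∃ T ∈ F, ∃ T' ∈ F, T.Incomparable T' ∧ T.IsMinSeparation T' Z

/-- The set of all leftmost minimum separations of pairs of incomparable tangles in `F`. -/
def leftmostSeparations (F : Set (Tangle κ)) : Set (Set U) :=
  {Z | ∃ T ∈ F, ∃ T' ∈ F, T.Incomparable T' ∧ T.IsLeftmostMinSeparation T' Z}

/-- The `i`-th layer: the separations `Nᵢ` collected so far, and the tangles `Fᵢ` dealt with. In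
each step the inclusion-minimal leftmost minimum separations of the remaining tangles are added to
`Nᵢ`, and `Fᵢ₊₁` consists of all tangles whose leftmost minimum separation from some tangle of `F`
has been collected. -/
def layer (F : Set (Tangle κ)) : ℕ → Set (Set U) × Set (Tangle κ)
  | 0 => (∅, ∅)
  | i + 1 =>
    let N := (layer F i).1 ∪ {Z | Minimal (fun X => X ∈ leftmostSeparations (F \ (layer F i).2)) Z}
    (N, {T ∈ F | ∃ T' ∈ F, ∃ Z ∈ N, T.IsLeftmostMinSeparation T' Z})

/-- The closure under complementation of the union of all layers. -/
def layeredFamily (F : Set (Tangle κ)) : Set (Set U) :=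
  {Z | ∃ i, Z ∈ (layer F i).1 ∨ Zᶜ ∈ (layer F i).1}

end Families

/-! ### Isomorphisms -/

/-- An isomorphism of connectivity functions. -/
structure ConnectivityFunction.Iso {U₁ U₂ : Type*}
    (κ₁ : ConnectivityFunction U₁) (κ₂ : ConnectivityFunction U₂) extends U₁ ≃ U₂ where
  map_eq : ∀ X : Set U₁, κ₁ X = κ₂ (toEquiv '' X)

/-- The image of a tangle under an isomorphism of connectivity functions. -/
def Tangle.map {U₁ U₂ : Type*} {κ₁ : ConnectivityFunction U₁} {κ₂ : ConnectivityFunction U₂}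
    (f : κ₁.Iso κ₂) (T : Tangle κ₁) : Tangle κ₂ where
  order := T.order
  sets := {Y | f.toEquiv ⁻¹' Y ∈ T.sets}
  lt_order Y hY := by
    have h := T.lt_order _ hY
    rwa [f.map_eq, Equiv.image_preimage] at h
  mem_or_compl_mem Y hY := by
    refine T.mem_or_compl_mem (f.toEquiv ⁻¹' Y) ?_
    rwa [f.map_eq, Equiv.image_preimage]
  inter_nonempty Y₁ h₁ Y₂ h₂ Y₃ h₃ := by
    obtain ⟨x, hx⟩ := T.inter_nonempty _ h₁ _ h₂ _ h₃
    exact ⟨f.toEquiv x, hx⟩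
  singleton_notMem a h := by
    refine T.singleton_notMem (f.toEquiv.symm a) ?_
    have e : f.toEquiv ⁻¹' {a} = {f.toEquiv.symm a} := by
      ext x
      simp [Equiv.eq_symm_apply]
    rw [← e]
    exact h

/-! ### Comprehensive tangle data structures -/

/-- The procedures of a tangle data structure on the ground set `U`, without any specification.
Tangles are accessed through natural numbers, their indices. The second argument of `find` is a
family of sets given by a membership oracle. -/
structure TangleProcedures (U : Type*) where
  order : ℕ
  size : ℕ → ℕ
  mem : ℕ → Set U → Bool
  tangleOrder : ℕ → ℕ
  trunc : ℕ → ℕ → ℕ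
  sep : ℕ → ℕ → Option (Set U)
  find : ℕ → Set (Set U) → ℕ

/-- The number of `κ`-tangles of order at most `ℓ`. Tangles of different order are distinct. -/
noncomputable def numTangles {U : Type*} (κ : ConnectivityFunction U) (ℓ : ℕ) : ℕ :=
  Set.ncard {T : Tangle κ | T.order ≤ ℓ}

namespace TangleProcedures

variable {U : Type*}

/-- `i` is an index of the data structure: it is one of `1, …, |D|`. -/
def IsIndex (D : TangleProcedures U) (κ : ConnectivityFunction U) (i : ℕ) : Prop :=
  1 ≤ i ∧ i ≤ numTangles κ D.order

/-- `T` is the tangle that the procedures describe at `i`. -/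
def Represents (D : TangleProcedures U) {κ : ConnectivityFunction U} (i : ℕ) (T : Tangle κ) :
    Prop :=
  D.tangleOrder i = T.order ∧ ∀ X, D.mem i X = true ↔ X ∈ T.sets

/-- The procedures form a comprehensive tangle data structure for `κ`. Nothing is assumed about
the answers outside the specified ranges of the arguments. -/
structure IsComprehensive (D : TangleProcedures U) (κ : ConnectivityFunction U) : Prop where
  size_eq : ∀ ℓ, 1 ≤ ℓ → ℓ ≤ D.order → D.size ℓ = numTangles κ ℓ
  exists_tangle : ∀ i, D.IsIndex κ i → ∃ T : Tangle κ, T.order ≤ D.order ∧ D.Represents i T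
  trunc_spec : ∀ (i ℓ : ℕ) (T : Tangle κ), D.IsIndex κ i → D.Represents i T → ℓ ≤ T.order →
    D.IsIndex κ (D.trunc i ℓ) ∧ D.Represents (D.trunc i ℓ) (T.truncate ℓ)
  trunc_of_lt : ∀ (i ℓ : ℕ) (T : Tangle κ), D.IsIndex κ i → D.Represents i T → T.order < ℓ →
    D.trunc i ℓ = i
  sep_spec : ∀ (i j : ℕ) (T T' : Tangle κ), D.IsIndex κ i → D.IsIndex κ j → i ≠ j →
    D.Represents i T → D.Represents j T' →
    ∀ Z, D.sep i j = some Z ↔ T.IsLeftmostMinSeparation T' Z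
  find_spec : ∀ T : Tangle κ, T.order ≤ D.order →
    D.IsIndex κ (D.find T.order T.sets) ∧ D.Represents (D.find T.order T.sets) T ∧
    ∀ i, D.IsIndex κ i → D.Represents i T → i = D.find T.order T.sets

end TangleProcedures

/-! ### Programs with access to a tangle data structure

A random access machine with addition and truncated subtraction, programmed in a structured
language. It has scalar variables and an unbounded two-dimensional memory, both holding natural
numbers. If the ground set is listed as `e 0, …, e (n - 1)`, then the row `r` of the memory holds
the set of all `e j` for which the cell `(r, j)` is nonzero. The data structure can be accessed only
by calls of its procedures (`find` is not made available at all), and sets can be output. -/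

/-- Expressions. -/
inductive Expr where
  | const (c : ℕ)
  | var (x : ℕ)
  | cell (row col : Expr)
  | add (a b : Expr)
  | sub (a b : Expr)

/-- Programs. -/
inductive Prog where
  | skip
  | assign (x : ℕ) (a : Expr)
  | store (row col a : Expr)
  | emit (row : Expr)
  | callOrder (x : ℕ)
  | callSize (x : ℕ) (l : Expr)
  | callMem (x : ℕ) (i row : Expr)
  | callTangleOrder (x : ℕ) (i : Expr)
  | callTrunc (x : ℕ) (i l : Expr)
  | callSep (x : ℕ) (row i j : Expr)
  | seq (p q : Prog)
  | ifNonzero (a : Expr) (p q : Prog)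
  | whileNonzero (a : Expr) (p : Prog)

/-- A configuration of the memory, with the list of the sets that have been output. -/
structure MachineState (U : Type*) where
  vars : ℕ → ℕ
  mem : ℕ → ℕ → ℕ
  out : List (Set U)

/-- The value of an expression. -/
def Expr.eval {U : Type*} (s : MachineState U) : Expr → ℕ
  | .const c => c
  | .var x => s.vars x
  | .cell r c => s.mem (r.eval s) (c.eval s)
  | .add a b => a.eval s + b.eval s
  | .sub a b => a.eval s - b.eval s

namespace MachineState

variable {U : Type*} {n : ℕ}

/-- The assignment of `v` to the variable `x`. -/
def setVar (s : MachineState U) (x v : ℕ) : MachineState U :=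
  { s with vars := Function.update s.vars x v }

/-- The assignment of `v` to the cell `(r, c)`. -/
def setCell (s : MachineState U) (r c v : ℕ) : MachineState U :=
  { s with mem := Function.update s.mem r (Function.update (s.mem r) c v) }

/-- The set held by row `r`. -/
def rowSet (e : Fin n ≃ U) (s : MachineState U) (r : ℕ) : Set U :=
  {u | s.mem r (e.symm u) ≠ 0}

open Classical in
/-- The first `n` cells of row `r` are overwritten by the indicator function of `Z`. -/
noncomputable def setRow (e : Fin n ≃ U) (s : MachineState U) (r : ℕ) (Z : Set U) :
    MachineState U :=
  { s with
    mem := Function.update s.mem r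
      (fun c => if h : c < n then (if e ⟨c, h⟩ ∈ Z then 1 else 0) else s.mem r c) }

/-- The set held by row `r` is output. -/
def emitRow (e : Fin n ≃ U) (s : MachineState U) (r : ℕ) : MachineState U :=
  { s with out := s.out ++ [s.rowSet e r] }

/-- The effect of an answer of `sep`: the variable `x` says whether there is a separation, and if
so, it is written into row `r`. -/
noncomputable def receiveSep (e : Fin n ≃ U) (s : MachineState U) (x r : ℕ) :
    Option (Set U) → MachineState U
  | none => s.setVar x 0
  | some Z => (s.setRow e r Z).setVar x 1

/-- The initial configuration: variable `0` holds `n`, variable `1` holds the number of the given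
indices, and row `0` holds the list of the given indices. All else is `0`. -/
def init (U : Type*) (n : ℕ) (L : List ℕ) : MachineState U where
  vars x := if x = 0 then n else if x = 1 then L.length else 0
  mem r c := if r = 0 then L.getD c 0 else 0
  out := []

end MachineState

/-- `Runs e D p s t s'`: the program `p`, started in `s`, halts after `t` steps in `s'`. Every
command and every test costs one step; if a set is passed to or from the machine, there are `n`
additional steps. -/
inductive Runs {U : Type*} {n : ℕ} (e : Fin n ≃ U) (D : TangleProcedures U) :
    Prog → MachineState U → ℕ → MachineState U → Prop
  | skip (s) : Runs e D .skip s 1 s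
  | assign (s x a) : Runs e D (.assign x a) s 1 (s.setVar x (a.eval s))
  | store (s r c a) : Runs e D (.store r c a) s 1 (s.setCell (r.eval s) (c.eval s) (a.eval s))
  | emit (s r) : Runs e D (.emit r) s (n + 1) (s.emitRow e (r.eval s))
  | callOrder (s x) : Runs e D (.callOrder x) s 1 (s.setVar x D.order)
  | callSize (s x l) : Runs e D (.callSize x l) s 1 (s.setVar x (D.size (l.eval s)))
  | callMem (s x i r) : Runs e D (.callMem x i r) s (n + 1)
      (s.setVar x (D.mem (i.eval s) (s.rowSet e (r.eval s))).toNat)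
  | callTangleOrder (s x i) : Runs e D (.callTangleOrder x i) s 1
      (s.setVar x (D.tangleOrder (i.eval s)))
  | callTrunc (s x i l) : Runs e D (.callTrunc x i l) s 1
      (s.setVar x (D.trunc (i.eval s) (l.eval s)))
  | callSep (s x r i j) : Runs e D (.callSep x r i j) s (n + 1)
      (s.receiveSep e x (r.eval s) (D.sep (i.eval s) (j.eval s)))
  | seq (p q s t s' t' s'') : Runs e D p s t s' → Runs e D q s' t' s'' →
      Runs e D (.seq p q) s (t + t') s''
  | ifTrue (a p q s t s') : a.eval s ≠ 0 → Runs e D p s t s' →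
      Runs e D (.ifNonzero a p q) s (t + 1) s'
  | ifFalse (a p q s t s') : a.eval s = 0 → Runs e D q s t s' →
      Runs e D (.ifNonzero a p q) s (t + 1) s'
  | whileTrue (a p s t s' t' s'') : a.eval s ≠ 0 → Runs e D p s t s' →
      Runs e D (.whileNonzero a p) s' t' s'' → Runs e D (.whileNonzero a p) s (t + t' + 1) s''
  | whileFalse (a p s) : a.eval s = 0 → Runs e D (.whileNonzero a p) s 1 s

/-! ### Inputs and outputs -/

/-- An input: a connectivity function on a finite set `U` and a coherent family of tangles of order
`k + 1`, presented to the machine by a list of the elements of `U`, a comprehensive tangle data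
structure, and a list of the indices of the tangles in the family. -/
structure CoherentInput (k : ℕ) (U : Type*) where
  κ : ConnectivityFunction U
  family : Set (Tangle κ)
  coherent : IsCoherent k family
  n : ℕ
  enum : Fin n ≃ U
  D : TangleProcedures U
  comprehensive : D.IsComprehensive κ
  indices : List ℕ
  nodup : indices.Nodup
  index_spec : ∀ i ∈ indices, D.IsIndex κ i ∧ ∃ T ∈ family, D.Represents i T
  index_complete : ∀ T ∈ family, ∃ i ∈ indices, D.Represents i T

/-- The program `p` halts on the input `I` after `t` steps, and `N` is the family of all sets that
it has output. -/
def Prog.Computes (p : Prog) {k : ℕ} {U : Type*} (I : CoherentInput k U) (t : ℕ)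
    (N : Set (Set U)) : Prop :=
  ∃ s, Runs I.enum I.D p (MachineState.init U I.n I.indices) t s ∧ N = {Z | Z ∈ s.out}

/-! ### Tangle axioms and incomparability. -/

section TangleLemmas

variable {U : Type*} {κ : ConnectivityFunction U} {k : ℕ} {F G : Set (Tangle κ)}
  {T T' S S' : Tangle κ} {X Y Z : Set U}

namespace Tangle

/-! Coherence concentrates everything at order `k`. Sets of order below `k` are oriented alike by
all tangles of the family, so a separation of two of them has order exactly `k` and is automatically
minimum. By submodularity the separations of a given pair are closed under intersection, hence a
leftmost one exists.

The heart is an uncrossing argument (`subset_or_subset_compl`): an inclusion-minimal leftmost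
separation `Z` of a coherent family `G` lies on one side of every separation of two tangles in `G`.
Therefore `Z` separates any tangle of `G` that contains it from all the others. So the minimal
leftmost separations are exactly the sets that serve as the leftmost separation of one tangle from
every other tangle of `G` (`IsolatesIn`, `minimal_iff`).

Three things follow. Nestedness: the two tangles behind a separation of a later layer are still
present in an earlier one, so uncrossing works across layers. As each round with two or more
remaining tangles deals with at least one, `|F|` rounds suffice, and two tangles are separated in
the round that first deals with one of them. Size: removing isolated tangles one at a time yields a
laminar family with at least `|G| - 1` nonempty members, so `|G| ≤ |U|² + 1` whatever `k` is.
Algorithm: a layer can be read off the table of leftmost separations by equality tests alone,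
without any search for minimal sets.

Canonicity is then formal: the machine is deterministic, and its output is `layeredFamily`, which
does not mention the presentation of the input and is transported by isomorphisms. -/

lemma false_of_inter (hX : X ∈ T.sets) (hY : Y ∈ T.sets) (hZ : Z ∈ T.sets)
    (h : ∀ u, u ∈ X → u ∈ Y → u ∉ Z) : False := by
  obtain ⟨u, ⟨h₁, h₂⟩, h₃⟩ := T.inter_nonempty X hX Y hY Z hZ
  exact h u h₁ h₂ h₃

lemma compl_notMem (hX : X ∈ T.sets) : Xᶜ ∉ T.sets := fun h =>
  false_of_inter hX hX h fun _ hu _ hu' => hu' hu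

lemma mem_of_inter_subset (hX : X ∈ T.sets) (hY : Y ∈ T.sets) (h : X ∩ Y ⊆ Z)
    (hZ : κ Z < T.order) : Z ∈ T.sets :=
  (T.mem_or_compl_mem Z hZ).resolve_right fun hc =>
    false_of_inter hX hY hc fun _ h₁ h₂ h₃ => h₃ (h ⟨h₁, h₂⟩)

lemma mem_of_subset (hX : X ∈ T.sets) (h : X ⊆ Z) (hZ : κ Z < T.order) : Z ∈ T.sets :=
  mem_of_inter_subset hX hX (fun _ hu => h hu.1) hZ

lemma eq_of_sets_subset (ho : T.order = T'.order) (h : T.sets ⊆ T'.sets) : T = T' := by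
  refine Tangle.ext ho (h.antisymm fun X hX => ?_)
  refine (T.mem_or_compl_mem X (ho ▸ T'.lt_order X hX)).resolve_right fun hc => ?_
  exact compl_notMem hX (h hc)

lemma incomparable_iff (ho : T.order = T'.order) : T.Incomparable T' ↔ T ≠ T' := by
  constructor
  · rintro h rfl
    exact h.1 subset_rfl
  · exact fun h => ⟨fun hs => h (eq_of_sets_subset ho hs),
      fun hs => h (eq_of_sets_subset ho.symm hs).symm⟩

lemma IsSeparation.symm (h : T.IsSeparation T' Z) : T'.IsSeparation T Zᶜ :=
  ⟨h.2, by rw [compl_compl]; exact h.1⟩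

lemma IsSeparation.ne (h : T.IsSeparation T' Z) : T ≠ T' := by
  rintro rfl
  exact compl_notMem h.1 h.2

lemma IsLeftmostMinSeparation.isSeparation (h : T.IsLeftmostMinSeparation T' Z) :
    T.IsSeparation T' Z := h.1.1

lemma IsLeftmostMinSeparation.unique (h : T.IsLeftmostMinSeparation T' Y)
    (h' : T.IsLeftmostMinSeparation T' Z) : Y = Z :=
  (h.2 _ h'.1).antisymm (h'.2 _ h.1)

end Tangle

/-! ### Separations in a coherent family and their uncrossing. -/

open Tangle

namespace IsCoherent

lemma mono (hF : IsCoherent k F) (h : G ⊆ F) : IsCoherent k G :=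
  ⟨fun T hT => hF.1 T (h hT), fun T hT T' hT' => hF.2 T (h hT) T' (h hT')⟩

lemma order_eq (hF : IsCoherent k F) (hT : T ∈ F) (hT' : T' ∈ F) : T.order = T'.order :=
  (hF.1 T hT).trans (hF.1 T' hT').symm

lemma incomparable_iff (hF : IsCoherent k F) (hT : T ∈ F) (hT' : T' ∈ F) :
    T.Incomparable T' ↔ T ≠ T' :=
  Tangle.incomparable_iff (hF.order_eq hT hT')

lemma lt_order (hF : IsCoherent k F) (hT : T ∈ F) (h : κ X ≤ k) : κ X < T.order := by
  rw [hF.1 T hT]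
  exact Nat.lt_succ_of_le h

lemma mem_of_lt (hF : IsCoherent k F) (hT : T ∈ F) (hT' : T' ∈ F) (hX : X ∈ T.sets)
    (h : κ X < k) : X ∈ T'.sets := by
  have h₁ : X ∈ (T.truncate k).sets := ⟨hX, h⟩
  rw [hF.2 T hT T' hT'] at h₁
  exact h₁.1

lemma connectivity_eq (hF : IsCoherent k F) (hT : T ∈ F) (hT' : T' ∈ F)
    (h : T.IsSeparation T' Z) : κ Z = k := by
  have h₁ := T.lt_order Z h.1
  rw [hF.1 T hT] at h₁
  refine (Nat.lt_succ_iff.1 h₁).antisymm (not_lt.1 fun hlt => ?_)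
  exact compl_notMem (hF.mem_of_lt hT hT' h.1 hlt) h.2

lemma isMinSeparation_iff (hF : IsCoherent k F) (hT : T ∈ F) (hT' : T' ∈ F) :
    T.IsMinSeparation T' Z ↔ T.IsSeparation T' Z :=
  ⟨fun h => h.1, fun h => ⟨h, fun Z' h' => by
    rw [hF.connectivity_eq hT hT' h, hF.connectivity_eq hT hT' h']⟩⟩

lemma isLeftmost_iff (hF : IsCoherent k F) (hT : T ∈ F) (hT' : T' ∈ F) :
    T.IsLeftmostMinSeparation T' Z ↔
      T.IsSeparation T' Z ∧ ∀ Z', T.IsSeparation T' Z' → Z ⊆ Z' := by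
  simp only [IsLeftmostMinSeparation, hF.isMinSeparation_iff hT hT']

lemma exists_isSeparation (hF : IsCoherent k F) (hT : T ∈ F) (hT' : T' ∈ F) (h : T ≠ T') :
    ∃ Z, T.IsSeparation T' Z := by
  obtain ⟨X, hX, hX'⟩ := Set.not_subset.1 ((hF.incomparable_iff hT hT').2 h).1
  exact ⟨X, hX, (T'.mem_or_compl_mem X
    (hF.order_eq hT hT' ▸ T.lt_order X hX)).resolve_left hX'⟩

/-- Submodularity, applied to two separations of order `k` of tangles in a coherent family. -/
lemma connectivity_inter_le (hX : κ X = k) (hY : κ Y = k) (h : k ≤ κ (X ∪ Y)) :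
    κ (X ∩ Y) ≤ k := by
  have := κ.submodular' X Y
  omega

/-- Separations of a fixed pair are closed under intersection. A union of order below `k` would
belong to both tangles by coherence, and in `T'` it would meet the two complements in the empty set;
so the union has order at least `k`, and submodularity bounds the intersection. -/
lemma exists_isLeftmost [Finite U] (hF : IsCoherent k F) (hT : T ∈ F) (hT' : T' ∈ F)
    (h : T ≠ T') : ∃ Z, T.IsLeftmostMinSeparation T' Z := by
  obtain ⟨Z, hZ⟩ := (Set.toFinite {Z | T.IsSeparation T' Z}).exists_minimal
    (hF.exists_isSeparation hT hT' h)
  refine ⟨Z, (hF.isLeftmost_iff hT hT').2 ⟨hZ.1, fun Y hY => ?_⟩⟩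
  have hs : T.IsSeparation T' Z := hZ.1
  have hle : κ (Z ∩ Y) ≤ k := by
    refine connectivity_inter_le (hF.connectivity_eq hT hT' hs) (hF.connectivity_eq hT hT' hY)
      (not_lt.1 fun hlt => ?_)
    have h₁ : Z ∪ Y ∈ T.sets := mem_of_subset hs.1 Set.subset_union_left (hF.lt_order hT hlt.le)
    exact false_of_inter (hF.mem_of_lt hT hT' h₁ hlt) hs.2 hY.2 fun u h₁ h₂ h₃ =>
      h₁.elim h₂ h₃
  have h₂ : T.IsSeparation T' (Z ∩ Y) :=
    ⟨mem_of_inter_subset hs.1 hY.1 subset_rfl (hF.lt_order hT hle),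
      mem_of_subset hs.2 (Set.compl_subset_compl.2 Set.inter_subset_left)
        (by rw [κ.map_compl']; exact hF.lt_order hT' hle)⟩
  exact fun u hu => (hZ.2 h₂ Set.inter_subset_left hu).2

/-- A minimal leftmost separation lies on one side of every separation that its own first tangle
orients in the same way as the given tangle. -/
lemma subset_or_subset_compl_aux [Finite U] (hG : IsCoherent k G)
    (hZ : Minimal (fun X => X ∈ leftmostSeparations G) Z) (hS : S ∈ G) (hS' : S' ∈ G)
    (hSZ : S.IsLeftmostMinSeparation S' Z) (hT : T ∈ G) (hT' : T' ∈ G)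
    (hX : T.IsSeparation T' X) (hXS : X ∈ S.sets) : Z ⊆ X ∨ Z ⊆ Xᶜ := by
  have hs := hSZ.isSeparation
  have hZk := hG.connectivity_eq hS hS' hs
  have hXk := hG.connectivity_eq hT hT' hX
  by_cases hu : k ≤ κ (Z ∪ X)
  · left
    have hle : κ (Z ∩ X) ≤ k := connectivity_inter_le hZk hXk hu
    have h₂ : S.IsSeparation S' (Z ∩ X) :=
      ⟨mem_of_inter_subset hs.1 hXS subset_rfl (hG.lt_order hS hle),
        mem_of_subset hs.2 (Set.compl_subset_compl.2 Set.inter_subset_left)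
          (by rw [κ.map_compl']; exact hG.lt_order hS' hle)⟩
    exact fun u hu => (((hG.isLeftmost_iff hS hS').1 hSZ).2 _ h₂ hu).2
  · right
    rw [not_le] at hu
    -- Now `Z ∪ X` has order below `k`, so it belongs to every tangle of `G`. Intersecting it with
    -- `Zᶜ` in `S'` and with `Xᶜ` in `T'` forces `X ∈ S'` and `Z ∈ T'`.
    have hmem : Z ∪ X ∈ S.sets :=
      mem_of_subset hs.1 Set.subset_union_left (hG.lt_order hS hu.le)
    have hXS' : X ∈ S'.sets := mem_of_inter_subset (hG.mem_of_lt hS hS' hmem hu) hs.2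
      (fun u hu => hu.1.resolve_left hu.2) (hG.lt_order hS' hXk.le)
    have hZT' : Z ∈ T'.sets := mem_of_inter_subset (hG.mem_of_lt hS hT' hmem hu) hX.2
      (fun u hu => hu.1.resolve_right hu.2) (hG.lt_order hT' hZk.le)
    have hXck : κ Xᶜ = k := by rw [κ.map_compl', hXk]
    have hle : κ (Z ∩ Xᶜ) ≤ k := by
      -- If `Z ∪ Xᶜ` also had order below `k`, it would lie in `S'` together with `X` and `Zᶜ`, and
      -- these three sets have empty intersection.
      refine connectivity_inter_le hZk hXck (not_lt.1 fun hlt => ?_)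
      have h₁ : Z ∪ Xᶜ ∈ T'.sets :=
        mem_of_subset hZT' Set.subset_union_left (hG.lt_order hT' hlt.le)
      exact false_of_inter (hG.mem_of_lt hT' hS' h₁ hlt) hXS' hs.2
        fun u h₁ h₂ h₃ => h₁.elim h₃ fun h => h h₂
    have h₂ : T'.IsSeparation T (Z ∩ Xᶜ) :=
      ⟨mem_of_inter_subset hZT' hX.2 subset_rfl (hG.lt_order hT' hle),
        mem_of_subset hX.1 (fun u hu h => h.2 hu)
          (by rw [κ.map_compl']; exact hG.lt_order hT hle)⟩
    -- Only here is minimality among all pairs used: `Z` contains a leftmost separation of the other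
    -- pair `(T', T)`, hence equals it.
    obtain ⟨Y, hY⟩ := hG.exists_isLeftmost hT' hT h₂.ne
    have hYZ : Y ⊆ Z ∩ Xᶜ := ((hG.isLeftmost_iff hT' hT).1 hY).2 _ h₂
    have h₃ := hZ.2 ⟨T', hT', T, hT, (hG.incomparable_iff hT' hT).2 h₂.ne, hY⟩
      (hYZ.trans Set.inter_subset_left)
    exact fun u hu => (hYZ (h₃ hu)).2

lemma subset_or_subset_compl [Finite U] (hG : IsCoherent k G)
    (hZ : Minimal (fun X => X ∈ leftmostSeparations G) Z) (hT : T ∈ G) (hT' : T' ∈ G)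
    (hX : T.IsSeparation T' X) : Z ⊆ X ∨ Z ⊆ Xᶜ := by
  obtain ⟨S, hS, S', hS', -, hSZ⟩ := hZ.1
  have hXk := hG.connectivity_eq hT hT' hX
  rcases S.mem_or_compl_mem X (hG.lt_order hS hXk.le) with h | h
  · exact hG.subset_or_subset_compl_aux hZ hS hS' hSZ hT hT' hX h
  · have := hG.subset_or_subset_compl_aux hZ hS hS' hSZ hT' hT hX.symm h
    rw [compl_compl] at this
    exact this.symm

end IsCoherent

/-! ### Minimal leftmost separations isolate a tangle. -/

/-- `Z` is the leftmost minimum separation of `S` from each of the other tangles of `G`. -/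
def IsolatesIn (G : Set (Tangle κ)) (S : Tangle κ) (Z : Set U) : Prop :=
  S ∈ G ∧ (∃ T ∈ G, T ≠ S) ∧ ∀ T ∈ G, T ≠ S → S.IsLeftmostMinSeparation T Z

namespace IsCoherent

/-- Take any `X` separating `S` from `T`. If `T` also contained `Z`, then `Z ⊆ X` would contradict
`Xᶜ ∈ T`, and `Z ⊆ Xᶜ` would contradict `X ∈ S`. -/
lemma isSeparation_of_minimal [Finite U] (hG : IsCoherent k G)
    (hZ : Minimal (fun X => X ∈ leftmostSeparations G) Z) (hS : S ∈ G) (hZS : Z ∈ S.sets)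
    (hT : T ∈ G) (h : S ≠ T) : S.IsSeparation T Z := by
  obtain ⟨X, hX⟩ := hG.exists_isSeparation hS hT h
  have hZk : κ Z < T.order := hG.order_eq hS hT ▸ S.lt_order Z hZS
  refine ⟨hZS, (T.mem_or_compl_mem Z hZk).resolve_left fun hZT => ?_⟩
  rcases hG.subset_or_subset_compl hZ hS hT hX with h | h
  · exact false_of_inter hZT hZT hX.2 fun u hu _ hu' => hu' (h hu)
  · exact false_of_inter hZS hZS hX.1 fun u hu _ hu' => h hu hu'

lemma isolatesIn_of_minimal [Finite U] (hG : IsCoherent k G)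
    (hZ : Minimal (fun X => X ∈ leftmostSeparations G) Z) (hS : S ∈ G) (hZS : Z ∈ S.sets) :
    IsolatesIn G S Z := by
  obtain ⟨R, hR, R', hR', -, hRZ⟩ := id hZ.1
  refine ⟨hS, ⟨R', hR', ?_⟩, fun T hT hne => ?_⟩
  · rintro rfl
    exact compl_notMem hZS hRZ.isSeparation.2
  · have hs := hG.isSeparation_of_minimal hZ hS hZS hT hne.symm
    obtain ⟨Y, hY⟩ := hG.exists_isLeftmost hS hT hne.symm
    have hYZ : Y ⊆ Z := ((hG.isLeftmost_iff hS hT).1 hY).2 _ hs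
    have h := hZ.2 ⟨S, hS, T, hT, (hG.incomparable_iff hS hT).2 hne.symm, hY⟩ hYZ
    rwa [hYZ.antisymm h] at hY

lemma exists_minimal_subset [Finite U] (hX : X ∈ leftmostSeparations G) :
    ∃ Z ⊆ X, Minimal (fun X => X ∈ leftmostSeparations G) Z :=
  (Set.toFinite (leftmostSeparations G)).exists_le_minimal hX

/-- A minimal `Y ⊆ Z` must belong to `S`, since any other tangle contains `Zᶜ`, which is disjoint
from `Y`. Then `Y` isolates `S` too, and uniqueness of leftmost separations gives `Y = Z`. -/
lemma minimal_of_isolatesIn [Finite U] (hG : IsCoherent k G) (h : IsolatesIn G S Z) :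
    Minimal (fun X => X ∈ leftmostSeparations G) Z := by
  obtain ⟨hS, ⟨T, hT, hne⟩, hall⟩ := h
  obtain ⟨Y, hYZ, hY⟩ := exists_minimal_subset
    (show Z ∈ leftmostSeparations G from
      ⟨S, hS, T, hT, (hG.incomparable_iff hS hT).2 hne.symm, hall T hT hne⟩)
  obtain ⟨R, hR, R', hR', -, hRY⟩ := id hY.1
  have hRS : R = S := by
    by_contra hRS
    exact false_of_inter hRY.isSeparation.1 hRY.isSeparation.1 (hall R hR hRS).isSeparation.2
      fun u hu _ hu' => hu' (hYZ hu)
  subst hRS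
  have := (hG.isolatesIn_of_minimal hY hS hRY.isSeparation.1).2.2 T hT hne
  rwa [this.unique (hall T hT hne)] at hY

lemma minimal_iff [Finite U] (hG : IsCoherent k G) :
    Minimal (fun X => X ∈ leftmostSeparations G) Z ↔ ∃ S, IsolatesIn G S Z := by
  refine ⟨fun h => ?_, fun ⟨S, hS⟩ => hG.minimal_of_isolatesIn hS⟩
  obtain ⟨R, hR, R', hR', -, hRY⟩ := id h.1
  exact ⟨R, hG.isolatesIn_of_minimal h hR hRY.isSeparation.1⟩

lemma exists_isolatesIn [Finite U] (hG : IsCoherent k G) (hT : T ∈ G) (hT' : T' ∈ G)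
    (h : T ≠ T') : ∃ S Z, IsolatesIn G S Z := by
  obtain ⟨X, hX⟩ := hG.exists_isLeftmost hT hT' h
  obtain ⟨Z, -, hZ⟩ := exists_minimal_subset
    (show X ∈ leftmostSeparations G from ⟨T, hT, T', hT', (hG.incomparable_iff hT hT').2 h, hX⟩)
  obtain ⟨S, hS⟩ := hG.minimal_iff.1 hZ
  exact ⟨S, Z, hS⟩

end IsCoherent

namespace IsolatesIn

lemma notMem_sets (h : IsolatesIn G S Z) (hT : T ∈ G) (hne : T ≠ S) : Z ∉ T.sets := fun hZ =>
  compl_notMem hZ (h.2.2 T hT hne).isSeparation.2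

end IsolatesIn

/-! ### Layers -/

lemma layer_succ_fst (F : Set (Tangle κ)) (i : ℕ) : (layer F (i + 1)).1 =
    (layer F i).1 ∪ {Z | Minimal (fun X => X ∈ leftmostSeparations (F \ (layer F i).2)) Z} :=
  rfl

lemma mem_layer_snd {i : ℕ} : T ∈ (layer F i).2 ↔
    T ∈ F ∧ ∃ T' ∈ F, ∃ Z ∈ (layer F i).1, T.IsLeftmostMinSeparation T' Z := by
  cases i with
  | zero => simp [layer]
  | succ i => rfl

lemma layer_fst_mono : Monotone fun i => (layer F i).1 :=
  monotone_nat_of_le_succ fun _ => Set.subset_union_left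

lemma layer_snd_mono : Monotone fun i => (layer F i).2 := fun i j hij T hT => by
  obtain ⟨h₁, T', hT', Z, hZ, h⟩ := mem_layer_snd.1 hT
  exact mem_layer_snd.2 ⟨h₁, T', hT', Z, layer_fst_mono hij hZ, h⟩

lemma exists_minimal_of_mem_layer_fst {i : ℕ} (h : Z ∈ (layer F i).1) :
    ∃ j, j < i ∧ Minimal (fun X => X ∈ leftmostSeparations (F \ (layer F j).2)) Z := by
  induction i with
  | zero => exact h.elim
  | succ i ih =>
    rcases h with h | h
    · obtain ⟨j, hj, hm⟩ := ih h
      exact ⟨j, by omega, hm⟩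
    · exact ⟨i, by omega, h⟩

namespace IsCoherent

lemma mem_layer_succ_fst [Finite U] (hF : IsCoherent k F) {i : ℕ} : Z ∈ (layer F (i + 1)).1 ↔
    Z ∈ (layer F i).1 ∨ ∃ S, IsolatesIn (F \ (layer F i).2) S Z := by
  rw [← (hF.mono Set.sdiff_subset).minimal_iff]
  rfl

/-- The definition allows a partner `T'` that was dealt with long ago. This makes no difference: a
tangle still present that contains a new minimal separation is isolated by it among the tangles
present. -/
lemma mem_layer_succ_snd [Finite U] (hF : IsCoherent k F) {i : ℕ} : T ∈ (layer F (i + 1)).2 ↔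
    T ∈ (layer F i).2 ∨ ∃ Z, IsolatesIn (F \ (layer F i).2) T Z := by
  constructor
  · intro h
    refine or_iff_not_imp_left.2 fun hT => ?_
    obtain ⟨hTF, T', hT', Z, hZ, hZT⟩ := mem_layer_snd.1 h
    rcases hZ with hZ | hZ
    · exact (hT (mem_layer_snd.2 ⟨hTF, T', hT', Z, hZ, hZT⟩)).elim
    · exact ⟨Z, (hF.mono Set.sdiff_subset).isolatesIn_of_minimal hZ ⟨hTF, hT⟩
        hZT.isSeparation.1⟩
  · rintro (h | ⟨Z, hZ⟩)
    · exact layer_snd_mono (Nat.le_succ i) h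
    · obtain ⟨T', hT', hne⟩ := hZ.2.1
      exact mem_layer_snd.2 ⟨hZ.1.1, T', hT'.1, Z, hF.mem_layer_succ_fst.2 (Or.inr ⟨T, hZ⟩),
        hZ.2.2 T' hT' hne⟩

/-- Progress measure: as long as two tangles remain, one of them is isolated and gets dealt with.
The last tangle may remain forever, whence `F.ncard - 1`. -/
lemma min_le_ncard_layer_snd [Finite U] (hF : IsCoherent k F) (hfin : F.Finite) (i : ℕ) :
    min i (F.ncard - 1) ≤ (layer F i).2.ncard := by
  induction i with
  | zero => simp
  | succ i ih =>
    have hsub : ∀ j, (layer F j).2 ⊆ F := fun j T hT => (mem_layer_snd.1 hT).1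
    have hmono : (layer F i).2 ⊆ (layer F (i + 1)).2 := layer_snd_mono (Nat.le_succ i)
    by_cases hc : F.ncard - 1 ≤ (layer F i).2.ncard
    · exact (min_le_right _ _).trans
        (hc.trans (Set.ncard_le_ncard hmono (hfin.subset (hsub _))))
    · have hd := Set.ncard_sdiff_add_ncard_of_subset (hsub i) hfin
      obtain ⟨T, hT, T', hT', hne⟩ :=
        (Set.one_lt_ncard (hfin.subset Set.sdiff_subset)).1
          (show 1 < (F \ (layer F i).2).ncard by omega)
      obtain ⟨S, Z, hS⟩ := (hF.mono Set.sdiff_subset).exists_isolatesIn hT hT' hne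
      have hlt : (layer F i).2.ncard < (layer F (i + 1)).2.ncard :=
        Set.ncard_lt_ncard (hmono.ssubset_of_mem_notMem
          (hF.mem_layer_succ_snd.2 (Or.inr ⟨Z, hS⟩)) hS.1.2) (hfin.subset (hsub _))
      omega

/-- After `F.ncard` rounds at most one tangle remains, while isolation needs two; so nothing is
added any more. -/
lemma layer_fst_subset [Finite U] (hF : IsCoherent k F) (hfin : F.Finite) (i : ℕ) :
    (layer F i).1 ⊆ (layer F F.ncard).1 := by
  rcases le_total i F.ncard with h | h
  · exact layer_fst_mono h
  · induction i, h using Nat.le_induction with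
    | base => exact subset_rfl
    | succ i hi ih =>
      intro Z hZ
      rcases hF.mem_layer_succ_fst.1 hZ with hZ | ⟨S, hS⟩
      · exact ih hZ
      · exfalso
        have h₁ := hF.min_le_ncard_layer_snd hfin i
        have hd := Set.ncard_sdiff_add_ncard_of_subset
          (fun T hT => (mem_layer_snd.1 hT).1 : (layer F i).2 ⊆ F) hfin
        obtain ⟨T, hT, hne⟩ := hS.2.1
        have h₂ := (Set.one_lt_ncard (hfin.subset Set.sdiff_subset)).2 ⟨T, hT, S, hS.1, hne⟩
        omega

lemma mem_layeredFamily_iff [Finite U] (hF : IsCoherent k F) (hfin : F.Finite) :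
    Z ∈ layeredFamily F ↔ Z ∈ (layer F F.ncard).1 ∨ Zᶜ ∈ (layer F F.ncard).1 :=
  ⟨fun ⟨i, h⟩ => h.imp (fun h => hF.layer_fst_subset hfin i h)
    (fun h => hF.layer_fst_subset hfin i h), fun h => ⟨_, h⟩⟩

lemma exists_isSeparation_of_mem_layer (hZ : ∃ i, Z ∈ (layer F i).1) :
    ∃ T ∈ F, ∃ T' ∈ F, T.IsSeparation T' Z := by
  obtain ⟨i, hi⟩ := hZ
  obtain ⟨j, -, hm⟩ := exists_minimal_of_mem_layer_fst hi
  obtain ⟨T, hT, T', hT', -, h⟩ := hm.1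
  exact ⟨T, hT.1, T', hT'.1, h.isSeparation⟩

/-- The tangles separated by `Y` in the later layer are still present in the earlier one, where `X`
is minimal. -/
lemma subset_or_subset_compl_of_layer_le [Finite U] (hF : IsCoherent k F) {i j : ℕ} (hij : i ≤ j)
    (hX : Minimal (fun X => X ∈ leftmostSeparations (F \ (layer F i).2)) X)
    (hY : Minimal (fun X => X ∈ leftmostSeparations (F \ (layer F j).2)) Y) :
    X ⊆ Y ∨ X ⊆ Yᶜ := by
  obtain ⟨T, hT, T', hT', -, h⟩ := hY.1
  exact (hF.mono Set.sdiff_subset).subset_or_subset_compl hX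
    ⟨hT.1, fun hc => hT.2 (layer_snd_mono hij hc)⟩
    ⟨hT'.1, fun hc => hT'.2 (layer_snd_mono hij hc)⟩ h.isSeparation

lemma isNestedFamilyFor [Finite U] (hF : IsCoherent k F) (hfin : F.Finite) :
    IsNestedFamilyFor (layeredFamily F) F where
  nested := by
    have key : ∀ X Y : Set U, (∃ i, X ∈ (layer F i).1) → (∃ i, Y ∈ (layer F i).1) →
        SepNested X Y := by
      rintro X Y ⟨i, hi⟩ ⟨j, hj⟩
      obtain ⟨i, -, hX⟩ := exists_minimal_of_mem_layer_fst hi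
      obtain ⟨j, -, hY⟩ := exists_minimal_of_mem_layer_fst hj
      rcases le_total i j with h | h
      · rcases hF.subset_or_subset_compl_of_layer_le h hX hY with h | h
        · exact Or.inl h
        · exact Or.inr (Or.inl h)
      · rcases hF.subset_or_subset_compl_of_layer_le h hY hX with h | h
        · exact Or.inr (Or.inr (Or.inr (Set.compl_subset_compl.2 h)))
        · exact Or.inr (Or.inl (Set.subset_compl_comm.1 h))
    have key' : ∀ X Y : Set U, (∃ i, X ∈ (layer F i).1 ∨ Xᶜ ∈ (layer F i).1) →
        (∃ i, Y ∈ (layer F i).1) → SepNested X Y := by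
      rintro X Y ⟨i, hi | hi⟩ hY
      · exact key X Y ⟨i, hi⟩ hY
      · have := key Xᶜ Y ⟨i, hi⟩ hY
        unfold SepNested at this ⊢
        rw [compl_compl] at this
        tauto
    rintro X hX Y ⟨j, hj | hj⟩
    · exact key' X Y hX ⟨j, hj⟩
    · have := key' X Yᶜ hX ⟨j, hj⟩
      unfold SepNested at this ⊢
      rw [compl_compl] at this
      tauto
  compl_mem := by
    rintro X ⟨i, hi⟩
    exact ⟨i, by rw [compl_compl]; exact hi.symm⟩
  separates := by
    have key : ∀ i, ∀ T ∈ F \ (layer F i).2, ∀ T' ∈ F \ (layer F i).2, T ≠ T' →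
        T ∈ (layer F (i + 1)).2 → ∃ Z ∈ layeredFamily F, T.IsSeparation T' Z := by
      intro i T hT T' hT' hne h
      obtain ⟨Z, hZ⟩ := (hF.mem_layer_succ_snd.1 h).resolve_left hT.2
      exact ⟨Z, ⟨i + 1, Or.inl (hF.mem_layer_succ_fst.2 (Or.inr ⟨T, hZ⟩))⟩,
        (hZ.2.2 T' hT' hne.symm).isSeparation⟩
    -- The induction finds the first round that deals with one of the two tangles. Both are present
    -- at its start, so the isolating set of that one separates it from the other; a complement is
    -- taken if it is the second of the pair.
    have main : ∀ i, ∀ T ∈ F, ∀ T' ∈ F, T ≠ T' →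
        (T ∈ (layer F i).2 ∨ T' ∈ (layer F i).2) →
        ∃ Z ∈ layeredFamily F, T.IsSeparation T' Z := by
      intro i
      induction i with
      | zero =>
        rintro T - T' - - (h | h) <;> exact h.elim
      | succ i ih =>
        intro T hT T' hT' hne h
        by_cases hc : T ∈ (layer F i).2 ∨ T' ∈ (layer F i).2
        · exact ih T hT T' hT' hne hc
        · rw [not_or] at hc
          rcases h with h | h
          · exact key i T ⟨hT, hc.1⟩ T' ⟨hT', hc.2⟩ hne h
          · obtain ⟨Z, ⟨j, hj⟩, hs⟩ := key i T' ⟨hT', hc.2⟩ T ⟨hT, hc.1⟩ hne.symm h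
            exact ⟨Zᶜ, ⟨j, by rw [compl_compl]; exact hj.symm⟩, hs.symm⟩
    intro T hT T' hT' hinc
    have hne := (hF.incomparable_iff hT hT').1 hinc
    obtain ⟨Z, hZ, hs⟩ : ∃ Z ∈ layeredFamily F, T.IsSeparation T' Z := by
      refine main F.ncard T hT T' hT' hne (by_contra fun hc => ?_)
      rw [not_or] at hc
      have h₁ := hF.min_le_ncard_layer_snd hfin F.ncard
      have hd := Set.ncard_sdiff_add_ncard_of_subset
        (fun T hT => (mem_layer_snd.1 hT).1 : (layer F F.ncard).2 ⊆ F) hfin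
      have h₂ := (Set.one_lt_ncard (hfin.subset Set.sdiff_subset)).2
        ⟨T, ⟨hT, hc.1⟩, T', ⟨hT', hc.2⟩, hne⟩
      omega
    exact ⟨Z, hZ, (hF.isMinSeparation_iff hT hT').2 hs⟩
  needed := by
    rintro Z ⟨i, hi | hi⟩
    · obtain ⟨T, hT, T', hT', h⟩ := exists_isSeparation_of_mem_layer ⟨i, hi⟩
      exact ⟨T, hT, T', hT', (hF.incomparable_iff hT hT').2 h.ne,
        (hF.isMinSeparation_iff hT hT').2 h⟩
    · obtain ⟨T, hT, T', hT', h⟩ := exists_isSeparation_of_mem_layer ⟨i, hi⟩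
      refine ⟨T', hT', T, hT, (hF.incomparable_iff hT' hT).2 h.ne.symm,
        (hF.isMinSeparation_iff hT' hT).2 ?_⟩
      simpa using h.symm

end IsCoherent

/-! ### The number of tangles in a coherent family -/

/-- A laminar family of nonempty sets has at most `|U|²` elements. -/
lemma card_le_of_laminar [Finite U] (L : Finset (Set U)) (hne : ∀ A ∈ L, A.Nonempty)
    (hL : ∀ A ∈ L, ∀ B ∈ L, A ⊆ B ∨ B ⊆ A ∨ A ⊆ Bᶜ) : L.card ≤ Nat.card U ^ 2 := by
  -- Each `A` is encoded by two points for which it is the least member containing both: one in a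
  -- maximal proper submember of `A` and one outside it, or the same point twice if there is no
  -- proper submember. The bound is crude but polynomial.
  have key : ∀ A ∈ L, ∃ p : U × U, p.1 ∈ A ∧ p.2 ∈ A ∧
      ∀ C ∈ L, p.1 ∈ C → p.2 ∈ C → A ⊆ C := by
    intro A hA
    by_cases h : ∃ B ∈ L, B ⊂ A
    · obtain ⟨B, hB⟩ := (L.finite_toSet.subset
        (show {B | B ∈ L ∧ B ⊂ A} ⊆ (L : Set (Set U)) from fun B hB => hB.1)).exists_maximal h
      obtain ⟨hBL, hBA⟩ : B ∈ L ∧ B ⊂ A := hB.1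
      obtain ⟨u, hu⟩ := hne B hBL
      obtain ⟨v, hv, hvB⟩ := Set.exists_of_ssubset hBA
      refine ⟨(u, v), hBA.1 hu, hv, fun C hC huC hvC => ?_⟩
      by_contra hAC
      have hCA : C ⊆ A := by
        rcases hL A hA C hC with h | h | h
        · exact (hAC h).elim
        · exact h
        · exact (h hv hvC).elim
      have hCB : B ⊆ C := by
        rcases hL B hBL C hC with h | h | h
        · exact h
        · exact (hvB (h hvC)).elim
        · exact (h hu huC).elim
      exact hvB (hB.2 ⟨hC, hCA, hAC⟩ hCB hvC)
    · obtain ⟨u, hu⟩ := hne A hA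
      refine ⟨(u, u), hu, hu, fun C hC huC _ => ?_⟩
      rcases hL A hA C hC with h' | h' | h'
      · exact h'
      · by_contra hAC
        exact h ⟨C, hC, h', hAC⟩
      · exact (h' hu huC).elim
  rcases L.eq_empty_or_nonempty with rfl | ⟨A₀, hA₀⟩
  · simp
  have : Nonempty (U × U) := ⟨(key A₀ hA₀).choose⟩
  choose! f hf using key
  have hinj : Set.InjOn f L := fun A hA B hB hAB => by
    refine ((hf A hA).2.2 B hB ?_ ?_).antisymm ((hf B hB).2.2 A hA ?_ ?_)
    · rw [hAB]; exact (hf B hB).1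
    · rw [hAB]; exact (hf B hB).2.1
    · rw [← hAB]; exact (hf A hA).1
    · rw [← hAB]; exact (hf A hA).2.1
  have := Set.ncard_le_ncard_of_injOn (t := Set.univ) f (fun _ _ => Set.mem_univ _) hinj
  rwa [Set.ncard_coe_finset, Set.ncard_univ, Nat.card_prod, ← sq] at this

namespace IsCoherent

/-- Induction by removing an isolated tangle `S`. Its set `Z` uncrosses from all separations of the
remaining tangles, and it is new because none of these tangles contains it. -/
lemma exists_laminar [Finite U] (hG : IsCoherent k G) (hfin : G.Finite) :
    ∃ L : Finset (Set U), G.ncard ≤ L.card + 1 ∧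
      (∀ A ∈ L, ∃ T ∈ G, ∃ T' ∈ G, T.IsSeparation T' A) ∧
      ∀ A ∈ L, ∀ B ∈ L, A ⊆ B ∨ B ⊆ A ∨ A ⊆ Bᶜ := by
  classical
  induction hm : G.ncard generalizing G with
  | zero => exact ⟨∅, by simp⟩
  | succ m ih =>
    by_cases h1 : m = 0
    · exact ⟨∅, by simp [h1]⟩
    obtain ⟨T, hT, T', hT', hne⟩ := (Set.one_lt_ncard hfin).1 (show 1 < G.ncard by omega)
    obtain ⟨S, Z, hS⟩ := hG.exists_isolatesIn hT hT' hne
    obtain ⟨L, hc, hsep, hlam⟩ := ih (hG.mono (Set.sdiff_subset (t := {S})))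
      (hfin.subset Set.sdiff_subset) (by rw [Set.ncard_sdiff_singleton_of_mem hS.1]; omega)
    have hcross : ∀ A ∈ L, Z ⊆ A ∨ Z ⊆ Aᶜ := fun A hA => by
      obtain ⟨R, hR, R', hR', h⟩ := hsep A hA
      exact hG.subset_or_subset_compl (hG.minimal_of_isolatesIn hS) hR.1 hR'.1 h
    have hZL : Z ∉ L := fun hZL => by
      obtain ⟨R, hR, R', hR', h⟩ := hsep Z hZL
      exact hS.notMem_sets hR.1 hR.2 h.1
    refine ⟨insert Z L, by rw [Finset.card_insert_of_notMem hZL]; omega, ?_, ?_⟩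
    · intro A hA
      rcases Finset.mem_insert.1 hA with rfl | hA
      · obtain ⟨R, hR, hRS⟩ := hS.2.1
        exact ⟨S, hS.1, R, hR, (hS.2.2 R hR hRS).isSeparation⟩
      · obtain ⟨R, hR, R', hR', h⟩ := hsep A hA
        exact ⟨R, hR.1, R', hR'.1, h⟩
    · intro A hA B hB
      rcases Finset.mem_insert.1 hA with hAZ | hA' <;>
        rcases Finset.mem_insert.1 hB with hBZ | hB'
      · exact Or.inl (hAZ.trans hBZ.symm).subset
      · exact hAZ ▸ (hcross B hB').imp_right Or.inr
      · exact hBZ ▸ Or.inr ((hcross A hA').imp_right fun h => Set.subset_compl_comm.1 h)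
      · exact hlam A hA' B hB'

lemma ncard_le [Finite U] (hG : IsCoherent k G) (hfin : G.Finite) :
    G.ncard ≤ Nat.card U ^ 2 + 1 := by
  obtain ⟨L, hc, hsep, hlam⟩ := hG.exists_laminar hfin
  have := card_le_of_laminar L (fun A hA => by
    obtain ⟨T, -, T', -, h⟩ := hsep A hA
    simpa using T.inter_nonempty A h.1 A h.1 A h.1) hlam
  omega

end IsCoherent

end TangleLemmas

/-! ### Invariance under isomorphisms -/

section Invariance

variable {U₁ U₂ : Type*} {κ₁ : ConnectivityFunction U₁} {κ₂ : ConnectivityFunction U₂}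
  (f : κ₁.Iso κ₂)

lemma Tangle.image_mem_map_sets {T : Tangle κ₁} {X : Set U₁} :
    f.toEquiv '' X ∈ (T.map f).sets ↔ X ∈ T.sets := by
  show f.toEquiv ⁻¹' (f.toEquiv '' X) ∈ T.sets ↔ _
  rw [Equiv.preimage_image]

lemma Tangle.map_injective : Function.Injective (Tangle.map f) := fun T T' h => by
  refine Tangle.ext (congrArg Tangle.order h :) (Set.ext fun X => ?_)
  rw [← image_mem_map_sets f, h, image_mem_map_sets]

lemma Tangle.map_sets_subset {T T' : Tangle κ₁} :
    (T.map f).sets ⊆ (T'.map f).sets ↔ T.sets ⊆ T'.sets := by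
  refine ⟨fun h X hX => ?_, fun h Y hY => h hY⟩
  exact (image_mem_map_sets f).1 (h ((image_mem_map_sets f).2 hX))

lemma Tangle.map_incomparable {T T' : Tangle κ₁} :
    (T.map f).Incomparable (T'.map f) ↔ T.Incomparable T' := by
  simp only [Incomparable, map_sets_subset]

lemma ConnectivityFunction.Iso.forall_set_iff {p : Set U₂ → Prop} :
    (∀ Y, p Y) ↔ ∀ X : Set U₁, p (f.toEquiv '' X) :=
  ⟨fun h X => h _, fun h Y => by simpa using h (f.toEquiv ⁻¹' Y)⟩

lemma Tangle.map_isSeparation {T T' : Tangle κ₁} {X : Set U₁} :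
    (T.map f).IsSeparation (T'.map f) (f.toEquiv '' X) ↔ T.IsSeparation T' X := by
  simp only [IsSeparation, ← Set.image_compl_eq f.toEquiv.bijective, image_mem_map_sets]

lemma Tangle.map_isMinSeparation {T T' : Tangle κ₁} {X : Set U₁} :
    (T.map f).IsMinSeparation (T'.map f) (f.toEquiv '' X) ↔ T.IsMinSeparation T' X := by
  simp only [IsMinSeparation, map_isSeparation, f.forall_set_iff, ← f.map_eq]

lemma Tangle.map_isLeftmostMinSeparation {T T' : Tangle κ₁} {X : Set U₁} :
    (T.map f).IsLeftmostMinSeparation (T'.map f) (f.toEquiv '' X) ↔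
      T.IsLeftmostMinSeparation T' X := by
  simp only [IsLeftmostMinSeparation, map_isMinSeparation, f.forall_set_iff,
    Set.image_subset_image_iff f.toEquiv.injective]

lemma image_mem_leftmostSeparations {F : Set (Tangle κ₁)} {X : Set U₁} :
    f.toEquiv '' X ∈ leftmostSeparations (Tangle.map f '' F) ↔ X ∈ leftmostSeparations F := by
  simp only [leftmostSeparations, Set.mem_ofPred_eq, Set.exists_mem_image, Tangle.map_incomparable,
    Tangle.map_isLeftmostMinSeparation]

lemma minimal_image {F : Set (Tangle κ₁)} {X : Set U₁} :
    Minimal (fun Y => Y ∈ leftmostSeparations (Tangle.map f '' F)) (f.toEquiv '' X) ↔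
      Minimal (fun Y => Y ∈ leftmostSeparations F) X := by
  simp only [Minimal, f.forall_set_iff, image_mem_leftmostSeparations,
    Set.image_subset_image_iff f.toEquiv.injective]

/-- Both components are carried together, since the separations of the next layer depend on the
tangles dealt with so far. -/
lemma layer_map (F : Set (Tangle κ₁)) (i : ℕ) :
    (∀ X, f.toEquiv '' X ∈ (layer (Tangle.map f '' F) i).1 ↔ X ∈ (layer F i).1) ∧
      (layer (Tangle.map f '' F) i).2 = Tangle.map f '' (layer F i).2 := by
  have snd : ∀ i, (∀ X, f.toEquiv '' X ∈ (layer (Tangle.map f '' F) i).1 ↔ X ∈ (layer F i).1) →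
      (layer (Tangle.map f '' F) i).2 = Tangle.map f '' (layer F i).2 := by
    intro i h
    ext T
    rw [mem_layer_snd]
    constructor
    · rintro ⟨⟨S, hS, rfl⟩, T', ⟨S', hS', rfl⟩, Z, hZ, hs⟩
      obtain ⟨X, rfl⟩ : ∃ X, f.toEquiv '' X = Z := ⟨_, f.toEquiv.image_preimage Z⟩
      exact ⟨S, mem_layer_snd.2 ⟨hS, S', hS', X, (h X).1 hZ,
        (Tangle.map_isLeftmostMinSeparation f).1 hs⟩, rfl⟩
    · rintro ⟨S, hS, rfl⟩
      obtain ⟨hS, S', hS', Z, hZ, hs⟩ := mem_layer_snd.1 hS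
      exact ⟨⟨S, hS, rfl⟩, _, ⟨S', hS', rfl⟩, _, (h Z).2 hZ,
        (Tangle.map_isLeftmostMinSeparation f).2 hs⟩
  induction i with
  | zero => exact ⟨fun X => Iff.rfl, by simp [layer]⟩
  | succ i ih =>
    have h : ∀ X, f.toEquiv '' X ∈ (layer (Tangle.map f '' F) (i + 1)).1 ↔
        X ∈ (layer F (i + 1)).1 := fun X => by
      rw [layer_succ_fst, layer_succ_fst, Set.mem_union, Set.mem_union, ih.1 X,
        Set.mem_ofPred_eq, Set.mem_ofPred_eq, ih.2, ← Set.image_sdiff (Tangle.map_injective f),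
        minimal_image]
    exact ⟨h, snd _ h⟩

lemma layeredFamily_map (F : Set (Tangle κ₁)) :
    layeredFamily (Tangle.map f '' F) = (fun X => f.toEquiv '' X) '' layeredFamily F := by
  ext Y
  obtain ⟨X, rfl⟩ : ∃ X, f.toEquiv '' X = Y := ⟨_, f.toEquiv.image_preimage Y⟩
  rw [(Set.image_injective.2 f.toEquiv.injective).mem_set_image]
  simp only [layeredFamily, Set.mem_ofPred_eq, ← Set.image_compl_eq f.toEquiv.bijective,
    (layer_map f F _).1]

end Invariance

/-! ### Time-bounded total correctness of programs -/

section Programs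

variable {U : Type*} {n : ℕ} {e : Fin n ≃ U} {D : TangleProcedures U}

/-- Determinism: it turns the existence of one good run into a statement about every run, as
canonicity requires. -/
lemma Runs.eq_of_runs {p : Prog} {s s₁ s₂ : MachineState U} {t₁ t₂ : ℕ}
    (h₁ : Runs e D p s t₁ s₁) (h₂ : Runs e D p s t₂ s₂) : s₁ = s₂ := by
  induction h₁ generalizing t₂ s₂ with
  | seq p q s t s' t' s'' _ _ ih ih' =>
    cases h₂ with
    | seq _ _ _ _ _ _ _ h h' =>
      obtain rfl := ih h
      exact ih' h'
  | ifTrue a p q s t s' ha _ ih =>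
    cases h₂ with
    | ifTrue _ _ _ _ _ _ _ h => exact ih h
    | ifFalse _ _ _ _ _ _ ha' => exact (ha ha').elim
  | ifFalse a p q s t s' ha _ ih =>
    cases h₂ with
    | ifTrue _ _ _ _ _ _ ha' => exact (ha' ha).elim
    | ifFalse _ _ _ _ _ _ _ h => exact ih h
  | whileTrue a p s t s' t' s'' ha _ _ ih ih' =>
    cases h₂ with
    | whileTrue _ _ _ _ _ _ _ _ h h' =>
      obtain rfl := ih h
      exact ih' h'
    | whileFalse _ _ _ ha' => exact (ha ha').elim
  | whileFalse a p s ha =>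
    cases h₂ with
    | whileTrue _ _ _ _ _ _ _ ha' => exact (ha' ha).elim
    | whileFalse => rfl
  | _ => cases h₂; rfl

/-- Started in `s`, the program `p` halts within `t` steps in a state that satisfies `Q`. -/
def Reaches (e : Fin n ≃ U) (D : TangleProcedures U) (p : Prog) (s : MachineState U) (t : ℕ)
    (Q : MachineState U → Prop) : Prop :=
  ∃ t' s', Runs e D p s t' s' ∧ t' ≤ t ∧ Q s'

/-- A loop in which the variable `x` runs down from `a - 1` to `0`. -/
def Prog.forDown (x : ℕ) (a : Expr) (p : Prog) : Prog :=
  .seq (.assign x a)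
    (.whileNonzero (.var x) (.seq (.assign x (.sub (.var x) (.const 1))) p))

namespace Reaches

variable {p q : Prog} {s : MachineState U} {t t' : ℕ} {Q R : MachineState U → Prop}

lemma mono (h : Reaches e D p s t Q) (ht : t ≤ t') (hQ : ∀ s', Q s' → R s') :
    Reaches e D p s t' R := by
  obtain ⟨t₁, s₁, h₁, h₂, h₃⟩ := h
  exact ⟨t₁, s₁, h₁, h₂.trans ht, hQ _ h₃⟩

lemma skip (h : Q s) : Reaches e D .skip s 1 Q := ⟨1, s, .skip s, le_rfl, h⟩

lemma assign {x : ℕ} {a : Expr} (h : Q (s.setVar x (a.eval s))) :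
    Reaches e D (.assign x a) s 1 Q := ⟨1, _, .assign s x a, le_rfl, h⟩

lemma store {r c a : Expr} (h : Q (s.setCell (r.eval s) (c.eval s) (a.eval s))) :
    Reaches e D (.store r c a) s 1 Q := ⟨1, _, .store s r c a, le_rfl, h⟩

lemma emit {r : Expr} (h : Q (s.emitRow e (r.eval s))) :
    Reaches e D (.emit r) s (n + 1) Q := ⟨_, _, .emit s r, le_rfl, h⟩

lemma callSep {x : ℕ} {r i j : Expr} {Z : Set U}
    (hZ : D.sep (i.eval s) (j.eval s) = some Z)
    (h : Q ((s.setRow e (r.eval s) Z).setVar x 1)) :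
    Reaches e D (.callSep x r i j) s (n + 1) Q := by
  refine ⟨_, _, .callSep s x r i j, le_rfl, ?_⟩
  rw [hZ]
  exact h

lemma seq (h : Reaches e D p s t fun s' => Reaches e D q s' t' Q) :
    Reaches e D (.seq p q) s (t + t') Q := by
  obtain ⟨t₁, s₁, h₁, ht₁, t₂, s₂, h₂, ht₂, hQ⟩ := h
  exact ⟨_, s₂, .seq _ _ _ _ _ _ _ h₁ h₂, by omega, hQ⟩

lemma ite {a : Expr} (h : a.eval s ≠ 0 → Reaches e D p s t Q)
    (h' : a.eval s = 0 → Reaches e D q s t Q) :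
    Reaches e D (.ifNonzero a p q) s (t + 1) Q := by
  by_cases ha : a.eval s = 0
  · obtain ⟨t₁, s₁, h₁, ht₁, hQ⟩ := h' ha
    exact ⟨_, s₁, .ifFalse _ _ _ _ _ _ ha h₁, by omega, hQ⟩
  · obtain ⟨t₁, s₁, h₁, ht₁, hQ⟩ := h ha
    exact ⟨_, s₁, .ifTrue _ _ _ _ _ _ ha h₁, by omega, hQ⟩

/-- The counter is decremented before the body runs, so the body at value `i` leads from `I (i + 1)`
to `I i`. An iteration costs two steps beyond its body, the test and the decrement. -/
lemma forDown_aux {x : ℕ} {I : ℕ → MachineState U → Prop} (hI : ∀ i s, I i s → s.vars x = i)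
    (N : ℕ) (hbody : ∀ i < N, ∀ s, I (i + 1) s → Reaches e D p (s.setVar x i) t (I i))
    (h : I N s) :
    Reaches e D (.whileNonzero (.var x) (.seq (.assign x (.sub (.var x) (.const 1))) p)) s
      (N * (t + 2) + 1) (I 0) := by
  induction N generalizing s with
  | zero => exact ⟨1, s, .whileFalse _ _ _ (hI 0 s h), by omega, h⟩
  | succ N ih =>
    obtain ⟨t₁, s₁, h₁, ht₁, hs₁⟩ := hbody N (Nat.lt_succ_self N) s h
    obtain ⟨t₂, s₂, h₂, ht₂, hs₂⟩ := ih (fun i hi => hbody i (by omega)) hs₁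
    have hx := hI _ s h
    have hev : (Expr.sub (.var x) (.const 1)).eval s = N := by simp [Expr.eval, hx]
    have h₀ : Runs e D (.assign x (.sub (.var x) (.const 1))) s 1 (s.setVar x N) := by
      have := Runs.assign (e := e) (D := D) s x (.sub (.var x) (.const 1))
      rwa [hev] at this
    refine ⟨_, s₂, .whileTrue _ _ _ _ _ _ _ (by simp [Expr.eval, hx])
      (.seq _ _ _ _ _ _ _ h₀ h₁) h₂, ?_, hs₂⟩
    rw [Nat.succ_mul]
    omega

lemma forDown {x : ℕ} {a : Expr} {N : ℕ} (I : ℕ → MachineState U → Prop)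
    (hI : ∀ i s, I i s → s.vars x = i) (ha : a.eval s = N) (h : I N (s.setVar x N))
    (hbody : ∀ i < N, ∀ s, I (i + 1) s → Reaches e D p (s.setVar x i) t (I i)) :
    Reaches e D (.forDown x a p) s (N * (t + 2) + 2) (I 0) := by
  subst ha
  exact (seq (assign (forDown_aux hI _ hbody h))).mono (by omega) fun _ => id

end Reaches

/-! ### Auxiliary programs -/

namespace MachineState

/-- The first `n` cells of row `r` hold the indicator function of `Z`. -/
def HoldsSet (e : Fin n ≃ U) (s : MachineState U) (r : ℕ) (Z : Set U) : Prop :=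
  ∀ j : Fin n, s.mem r j ≤ 1 ∧ (s.mem r j ≠ 0 ↔ e j ∈ Z)

lemma HoldsSet.rowSet_eq {s : MachineState U} {r : ℕ} {Z : Set U} (h : s.HoldsSet e r Z) :
    s.rowSet e r = Z := by
  ext u
  simpa [rowSet] using (h (e.symm u)).2

lemma holdsSet_setRow (s : MachineState U) (r : ℕ) (Z : Set U) :
    (s.setRow e r Z).HoldsSet e r Z := by
  intro j
  by_cases h : e j ∈ Z <;> simp [setRow, h]

/-- The bound `≤ 1` in `HoldsSet` is needed here: rows with different nonzero entries could hold the
same set. -/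
lemma HoldsSet.eq_iff {s : MachineState U} {r r' : ℕ} {Z Z' : Set U} (h : s.HoldsSet e r Z)
    (h' : s.HoldsSet e r' Z') : (∀ c < n, s.mem r c = s.mem r' c) ↔ Z = Z' := by
  constructor
  · intro heq
    rw [← h.rowSet_eq, ← h'.rowSet_eq]
    ext u
    simp [rowSet, heq _ (e.symm u).2]
  · rintro rfl c hc
    have h₁ := h ⟨c, hc⟩
    have h₂ := h' ⟨c, hc⟩
    simp only at h₁ h₂
    by_cases hz : e ⟨c, hc⟩ ∈ Z <;> simp only [hz, iff_true, iff_false, not_not] at h₁ h₂ <;> omega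

/-- The variables `0, …, 3`, the rows `0` and `1` and the output are the same in `s` and `s'`. -/
structure Frame (s s' : MachineState U) : Prop where
  vars_eq : ∀ x ≤ 3, s'.vars x = s.vars x
  mem_eq : ∀ r ≤ 1, s'.mem r = s.mem r
  out_eq : s'.out = s.out

lemma Frame.refl (s : MachineState U) : Frame s s := ⟨fun _ _ => rfl, fun _ _ => rfl, rfl⟩

lemma Frame.trans {s s' s'' : MachineState U} (h : Frame s s') (h' : Frame s' s'') :
    Frame s s'' :=
  ⟨fun x hx => (h'.vars_eq x hx).trans (h.vars_eq x hx),
    fun r hr => (h'.mem_eq r hr).trans (h.mem_eq r hr), h'.out_eq.trans h.out_eq⟩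

lemma Frame.setVar {s s' : MachineState U} (h : Frame s s') {x : ℕ} (hx : 3 < x) (v : ℕ) :
    Frame s (s'.setVar x v) :=
  ⟨fun y hy => by rw [← h.vars_eq y hy]; exact Function.update_of_ne (by omega) _ _,
    h.mem_eq, h.out_eq⟩

lemma Frame.setRow {s s' : MachineState U} (h : Frame s s') {r : ℕ} (hr : 1 < r) (Z : Set U) :
    Frame s (s'.setRow e r Z) :=
  ⟨h.vars_eq, fun q hq => by
    rw [← h.mem_eq q hq]; exact Function.update_of_ne (by omega) _ _, h.out_eq⟩

lemma Frame.setCell {s s' : MachineState U} (h : Frame s s') {r : ℕ} (hr : 1 < r) (c v : ℕ) :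
    Frame s (s'.setCell r c v) :=
  ⟨h.vars_eq, fun q hq => by
    rw [← h.mem_eq q hq]; exact Function.update_of_ne (by omega) _ _, h.out_eq⟩

end MachineState

open MachineState

/-- Nonzero if and only if the values of `a` and `b` differ. -/
def Expr.dist (a b : Expr) : Expr := .add (.sub a b) (.sub b a)

lemma Expr.dist_eval_eq_zero {a b : Expr} {s : MachineState U} :
    (Expr.dist a b).eval s = 0 ↔ a.eval s = b.eval s := by
  simp only [Expr.dist, Expr.eval]
  omega

/-- Variable `6` is set to `0` if the rows `2` and `3` differ. -/
def Prog.compareRows : Prog :=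
  .forDown 7 (.var 0) (.ifNonzero
    (.dist (.cell (.const 2) (.var 7)) (.cell (.const 3) (.var 7)))
    (.assign 6 (.const 0)) .skip)

/-- Variable `6` is never set back to a nonzero value, so repeated comparisons accumulate a
conjunction. -/
lemma reaches_compareRows {s : MachineState U} (hn : s.vars 0 = n) :
    Reaches e D .compareRows s (n * 4 + 2) fun s' => Frame s s' ∧ s'.mem = s.mem ∧
      s'.vars 4 = s.vars 4 ∧ s'.vars 5 = s.vars 5 ∧
      (s'.vars 6 ≠ 0 ↔ s.vars 6 ≠ 0 ∧ ∀ c < n, s.mem 2 c = s.mem 3 c) := by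
  refine (Reaches.forDown (t := 2) (N := n) (fun i s' => s'.vars 7 = i ∧ Frame s s' ∧
      s'.mem = s.mem ∧ s'.vars 4 = s.vars 4 ∧ s'.vars 5 = s.vars 5 ∧
      (s'.vars 6 ≠ 0 ↔ s.vars 6 ≠ 0 ∧ ∀ c, i ≤ c → c < n → s.mem 2 c = s.mem 3 c))
    (fun i s h => h.1) (show (Expr.var 0).eval s = n from hn) ?_ ?_).mono (by omega) ?_
  · refine ⟨rfl, (Frame.refl s).setVar (by omega) _, rfl, rfl, rfl, ?_⟩
    exact ⟨fun h => ⟨h, fun c h₁ h₂ => by omega⟩, fun h => h.1⟩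
  · rintro i hi s' ⟨h7, hf, hm, h4, h5, h6⟩
    refine Reaches.ite (fun hne => Reaches.assign ?_) (fun heq => Reaches.skip ?_)
    · refine ⟨rfl, (hf.setVar (by omega) _).setVar (by omega) _, hm, h4, h5, ?_⟩
      rw [Ne, Expr.dist_eval_eq_zero] at hne
      simp only [Expr.eval, setVar, Function.update_self, hm] at hne ⊢
      simp only [ne_eq, not_true_eq_false, false_iff, not_and, not_forall]
      exact fun _ => ⟨i, le_rfl, hi, hne⟩
    · refine ⟨rfl, hf.setVar (by omega) _, hm, h4, h5, ?_⟩
      rw [Expr.dist_eval_eq_zero] at heq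
      simp only [Expr.eval, setVar, Function.update_self, hm] at heq
      show s'.vars 6 ≠ 0 ↔ _
      rw [h6]
      refine and_congr_right fun _ => ⟨fun h c hc hc' => ?_, fun h c hc => h c (by omega)⟩
      rcases hc.eq_or_lt with rfl | hc
      · exact heq
      · exact h c hc hc'
  · rintro s' ⟨-, hf, hm, h4, h5, h6⟩
    exact ⟨hf, hm, h4, h5, by simpa using h6⟩

/-- Row `4` becomes the complement of row `2`. -/
def Prog.complementRow : Prog :=
  .forDown 7 (.var 0) (.store (.const 4) (.var 7)
    (.sub (.const 1) (.cell (.const 2) (.var 7))))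

lemma reaches_complementRow {s : MachineState U} (hn : s.vars 0 = n) {Z : Set U}
    (hZ : s.rowSet e 2 = Z) :
    Reaches e D .complementRow s (n * 3 + 2) fun s' => Frame s s' ∧ s'.rowSet e 4 = Zᶜ := by
  refine (Reaches.forDown (t := 1) (N := n) (fun i s' => s'.vars 7 = i ∧ Frame s s' ∧
      s'.mem 2 = s.mem 2 ∧ ∀ c, i ≤ c → c < n → s'.mem 4 c = 1 - s.mem 2 c)
    (fun i s h => h.1) (show (Expr.var 0).eval s = n from hn) ?_ ?_).mono (by omega) ?_
  · exact ⟨rfl, (Frame.refl s).setVar (by omega) _, rfl, fun c h₁ h₂ => by omega⟩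
  · rintro i hi s' ⟨h7, hf, hm, h4⟩
    refine Reaches.store ⟨rfl, (hf.setVar (by omega) _).setCell ?_ _ _, ?_, fun c hc hc' => ?_⟩
    · simp [Expr.eval]
    · rw [← hm]
      simp [setCell, setVar, Expr.eval]
    · simp only [Expr.eval, setVar, setCell, Function.update_self, hm]
      rcases hc.eq_or_lt with rfl | hc
      · rw [Function.update_self]
      · rw [Function.update_of_ne (by omega)]
        exact h4 c hc hc'
  · rintro s' ⟨-, hf, -, h4⟩
    refine ⟨hf, ?_⟩
    ext u
    subst hZ
    have := h4 (e.symm u) (Nat.zero_le _) (e.symm u).2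
    simp only [rowSet, Set.mem_ofPred_eq, Set.mem_compl_iff, this]
    -- With truncated subtraction, `1 - x` is nonzero exactly when `x = 0`.
    omega

/-! ### The search for isolated tangles -/

/-- Nonzero if and only if the tangle at position `a` of the list was dealt with before the
current round. -/
def Expr.dead (a : Expr) : Expr := .sub (.cell (.const 1) a) (.add (.var 2) (.const 1))

/-- If variable `3` holds `a`, then after this program variable `5` says whether there are
remaining tangles other than the one at position `a`, variable `6` says whether the latter has the
same leftmost separation from all of them, and row `2` holds one of these separations. -/
def Prog.scan : Prog :=
  .forDown 4 (.var 1) (.ifNonzero (.dead (.var 4)) .skip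
    (.ifNonzero (.dist (.var 3) (.var 4))
      (.ifNonzero (.var 5)
        (.seq (.callSep 8 (.const 3) (.cell (.const 0) (.var 3)) (.cell (.const 0) (.var 4)))
          .compareRows)
        (.seq (.callSep 8 (.const 2) (.cell (.const 0) (.var 3)) (.cell (.const 0) (.var 4)))
          (.assign 5 (.const 1))))
      .skip))

/-- `Z` is the common value of all `W a b` for `b ≠ a` with `alive b`, and there is such a `b`. -/
def IsCommonValue (m : ℕ) (W : ℕ → ℕ → Set U) (alive : ℕ → Prop) (a : ℕ) (Z : Set U) : Prop :=
  (∃ b < m, alive b ∧ b ≠ a) ∧ ∀ b < m, alive b → b ≠ a → W a b = Z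

/-- The part of the state that stays fixed during a round. -/
structure RoundState (D : TangleProcedures U) (n m ρ : ℕ) (W : ℕ → ℕ → Set U)
    (alive : ℕ → Prop) (s : MachineState U) : Prop where
  vars_zero : s.vars 0 = n
  vars_one : s.vars 1 = m
  vars_two : s.vars 2 = ρ
  sep_eq : ∀ a < m, ∀ b < m, a ≠ b → D.sep (s.mem 0 a) (s.mem 0 b) = some (W a b)
  le_iff : ∀ a < m, s.mem 1 a ≤ ρ + 1 ↔ alive a

lemma RoundState.of_frame {m ρ : ℕ} {W : ℕ → ℕ → Set U} {alive : ℕ → Prop}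
    {s s' : MachineState U} (h : RoundState D n m ρ W alive s) (hf : Frame s s') :
    RoundState D n m ρ W alive s' where
  vars_zero := (hf.vars_eq 0 (by omega)).trans h.vars_zero
  vars_one := (hf.vars_eq 1 (by omega)).trans h.vars_one
  vars_two := (hf.vars_eq 2 (by omega)).trans h.vars_two
  sep_eq := by rw [hf.mem_eq 0 (by omega)]; exact h.sep_eq
  le_iff := by rw [hf.mem_eq 1 (by omega)]; exact h.le_iff

/-- Row `1` holds stamps: `0` for an untreated tangle, `ρ + 1` for one dealt with in round `ρ`. As
`ρ` runs downwards, earlier rounds leave stamps above `ρ + 1`; a stamp equal to `ρ + 1` still counts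
as present, so dealing with a tangle does not affect the rest of its own round. -/
lemma RoundState.dead_eval {m ρ : ℕ} {W : ℕ → ℕ → Set U} {alive : ℕ → Prop}
    {s : MachineState U} (h : RoundState D n m ρ W alive s) {a : Expr} (ha : a.eval s < m) :
    (Expr.dead a).eval s = 0 ↔ alive (a.eval s) := by
  rw [← h.le_iff _ ha]
  simp only [Expr.dead, Expr.eval, h.vars_two]
  omega

/-- The loop invariant of `Prog.scan`. -/
def ScanInvariant (e : Fin n ≃ U) (m : ℕ) (W : ℕ → ℕ → Set U) (alive : ℕ → Prop) (a i : ℕ)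
    (s : MachineState U) : Prop :=
  (s.vars 5 = 0 ∧ s.vars 6 ≠ 0 ∧ ∀ b, i ≤ b → b < m → alive b → b = a) ∨
    (s.vars 5 ≠ 0 ∧ ∃ b₀ < m, alive b₀ ∧ b₀ ≠ a ∧ s.HoldsSet e 2 (W a b₀) ∧
      (s.vars 6 ≠ 0 ↔ ∀ b, i ≤ b → b < m → alive b → b ≠ a → W a b = W a b₀))

lemma forall_ge_lt_iff {p : ℕ → Prop} {i m : ℕ} (hi : i < m) :
    (∀ b, i ≤ b → b < m → p b) ↔ p i ∧ ∀ b, i + 1 ≤ b → b < m → p b := by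
  refine ⟨fun h => ⟨h i le_rfl hi, fun b hb => h b (by omega)⟩, fun h b hb hbm => ?_⟩
  rcases hb.eq_or_lt with rfl | hb
  · exact h.1
  · exact h.2 b hb hbm

lemma ScanInvariant.skip {m : ℕ} {W : ℕ → ℕ → Set U} {alive : ℕ → Prop} {a i : ℕ}
    {s : MachineState U} (h : ScanInvariant e m W alive a (i + 1) s) (hi : i < m)
    (hn : ¬ (alive i ∧ i ≠ a)) : ScanInvariant e m W alive a i s := by
  refine h.imp ?_ ?_
  · rintro ⟨g5, g6, h⟩
    exact ⟨g5, g6, (forall_ge_lt_iff hi).2 ⟨fun h => by tauto, h⟩⟩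
  · rintro ⟨g5, b₀, hb₀, hal, hne, hz, h⟩
    refine ⟨g5, b₀, hb₀, hal, hne, hz, ?_⟩
    rw [forall_ge_lt_iff hi, ← h]
    exact ⟨fun h => ⟨by tauto, h⟩, fun h => h.2⟩

/-- The first separation met goes into row `2` as reference; all later ones go into row `3` and are
compared with it. -/
lemma reaches_scan {m ρ a : ℕ} {W : ℕ → ℕ → Set U} {alive : ℕ → Prop} {s : MachineState U}
    (hs : RoundState D n m ρ W alive s) (h3 : s.vars 3 = a) (ha : a < m) (h5 : s.vars 5 = 0)
    (h6 : s.vars 6 ≠ 0) :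
    Reaches e D .scan s (m * (n * 5 + 8) + 2) fun s' => Frame s s' ∧
      ((s'.vars 5 ≠ 0 ∧ s'.vars 6 ≠ 0) ↔ ∃ Z, IsCommonValue m W alive a Z) ∧
      ∀ Z, IsCommonValue m W alive a Z → s'.rowSet e 2 = Z := by
  refine (Reaches.forDown (t := n * 5 + 6) (N := m)
    (fun i s' => s'.vars 4 = i ∧ Frame s s' ∧ ScanInvariant e m W alive a i s')
    (fun i s h => h.1) (show (Expr.var 1).eval s = m from hs.vars_one) ?_ ?_).mono le_rfl ?_
  · exact ⟨rfl, (Frame.refl s).setVar (by omega) _, Or.inl ⟨h5, h6, fun b h₁ h₂ => by omega⟩⟩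
  · rintro i hi s' ⟨h4, hf, hI⟩
    have hf' : Frame s (s'.setVar 4 i) := hf.setVar (by omega) _
    have hI' : ScanInvariant e m W alive a (i + 1) (s'.setVar 4 i) := hI
    have hr := hs.of_frame hf'
    have hv3 : (s'.setVar 4 i).vars 3 = a := (hf'.vars_eq 3 le_rfl).trans h3
    have hv4 : (s'.setVar 4 i).vars 4 = i := rfl
    clear h4 hf hI
    generalize s'.setVar 4 i = s₁ at *
    have hdead := hr.dead_eval (a := .var 4) (show s₁.vars 4 < m by omega)
    have hev : (Expr.var 4).eval s₁ = i := hv4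
    rw [hev] at hdead
    refine (Reaches.ite (t := n * 5 + 5) (fun hd => ?_) (fun hd => ?_)).mono le_rfl fun _ => id
    · exact (Reaches.skip ⟨hv4, hf', hI'.skip hi fun h => hd (hdead.2 h.1)⟩).mono (by omega)
        fun _ => id
    refine (Reaches.ite (t := n * 5 + 4) (fun hia => ?_) (fun hia => ?_)).mono le_rfl fun _ => id
    swap
    · rw [Expr.dist_eval_eq_zero] at hia
      refine (Reaches.skip ⟨hv4, hf', hI'.skip hi fun h => h.2 ?_⟩).mono (by omega) fun _ => id
      rw [← hv4, ← hv3]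
      exact hia.symm
    have hal := hdead.1 hd
    have hai : i ≠ a := by
      rw [Ne, Expr.dist_eval_eq_zero] at hia
      rw [← hv4, ← hv3]
      exact fun h => hia h.symm
    have hsep : D.sep ((Expr.cell (.const 0) (.var 3)).eval s₁)
        ((Expr.cell (.const 0) (.var 4)).eval s₁) = some (W a i) := by
      simp only [Expr.eval, hv3, hv4]
      exact hr.sep_eq a ha i hi hai.symm
    refine (Reaches.ite (t := n * 5 + 3) (fun hfound => ?_) (fun hfound => ?_)).mono le_rfl
      fun _ => id
    · refine (Reaches.seq (t' := n * 4 + 2) (Reaches.callSep hsep ((reaches_compareRows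
        (s := (s₁.setRow e 3 (W a i)).setVar 8 1) hr.vars_zero).mono le_rfl ?_))).mono (by omega) fun _ => id
      rintro s₂ ⟨hf₂, hm, g4, g5, g6⟩
      rcases hI' with ⟨h5', -⟩ | ⟨-, b₀, hb₀, halb, hne, hz, h⟩
      · exact (hfound h5').elim
      have hz₂ : ((s₁.setRow e 3 (W a i)).setVar 8 1).HoldsSet e 2 (W a b₀) := by
        simpa only [HoldsSet, setRow, setVar, Function.update_of_ne (show (2 : ℕ) ≠ 3 by omega)]
          using hz
      have hz₃ : ((s₁.setRow e 3 (W a i)).setVar 8 1).HoldsSet e 3 (W a i) :=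
        holdsSet_setRow s₁ 3 (W a i)
      refine ⟨g4.trans hv4, ?_, Or.inr ⟨?_, b₀, hb₀, halb, hne, ?_, ?_⟩⟩
      · exact ((hf'.setRow (r := 3) (by omega) _).setVar (x := 8) (by omega) _).trans hf₂
      · rw [g5]
        exact hfound
      · simpa only [HoldsSet, hm] using hz₂
      · rw [g6]
        refine Iff.trans (and_congr h (hz₂.eq_iff hz₃)) ?_
        rw [forall_ge_lt_iff hi]
        exact ⟨fun h => ⟨fun _ _ => h.2.symm, h.1⟩, fun h => ⟨h.2, (h.1 hal hai).symm⟩⟩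
    · refine (Reaches.seq (Reaches.callSep hsep (Reaches.assign ⟨hv4, ?_, Or.inr ⟨?_, i, hi, hal,
        hai, holdsSet_setRow s₁ 2 (W a i), ?_⟩⟩))).mono (by omega) fun _ => id
      · exact ((hf'.setRow (r := 2) (by omega) _).setVar (x := 8) (by omega) _).setVar
          (by omega) _
      · exact one_ne_zero
      · rcases hI' with ⟨-, h6', hb⟩ | ⟨h5', -⟩
        · refine iff_of_true h6' ((forall_ge_lt_iff hi).2 ⟨fun _ _ => rfl, ?_⟩)
          exact fun b hb₁ hb₂ hal' hne => (hne (hb b hb₁ hb₂ hal')).elim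
        · exact (h5' hfound).elim
  · rintro s' ⟨-, hf, hI⟩
    refine ⟨hf, ?_⟩
    rcases hI with ⟨g5, g6, h⟩ | ⟨g5, b₀, hb₀, hal, hne, hz, h⟩
    · have hno : ¬ ∃ Z, IsCommonValue m W alive a Z := by
        rintro ⟨Z, ⟨b, hb, hal, hne⟩, -⟩
        exact hne (h b (Nat.zero_le _) hb hal)
      exact ⟨by simp [g5, hno], fun Z hZ => (hno ⟨Z, hZ⟩).elim⟩
    · refine ⟨⟨fun hg => ⟨W a b₀, ⟨b₀, hb₀, hal, hne⟩, fun b hb => h.1 hg.2 b (Nat.zero_le _) hb⟩,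
        ?_⟩, ?_⟩
      · rintro ⟨Z, -, hZ⟩
        refine ⟨g5, h.2 fun b _ hb hal' hne' => ?_⟩
        rw [hZ b hb hal' hne', hZ b₀ hb₀ hal hne]
      · rintro Z ⟨-, hZ⟩
        rw [hz.rowSet_eq, hZ b₀ hb₀ hal hne]

/-! ### Rounds -/

/-- The tangle whose position is held by variable `3` is dealt with: if its leftmost separations
from the other remaining tangles coincide, then this separation and its complement are output, and
the current round is recorded. -/
def Prog.treatTangle : Prog :=
  .ifNonzero (.dead (.var 3)) .skip
    (.seq (.assign 5 (.const 0)) (.seq (.assign 6 (.const 1)) (.seq .scan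
      (.ifNonzero (.var 5) (.ifNonzero (.var 6)
        (.seq (.emit (.const 2)) (.seq .complementRow (.seq (.emit (.const 4))
          (.store (.const 1) (.var 3) (.add (.var 2) (.const 1))))))
        .skip) .skip))))

/-- One round, in which all remaining tangles are treated. -/
def Prog.round : Prog := .forDown 3 (.var 1) .treatTangle

/-- In each round, the inclusion-minimal leftmost separations of the remaining tangles and their
complements are output. There are as many rounds as tangles. -/
def Prog.layers : Prog := .forDown 2 (.var 1) .round

lemma reaches_treatTangle {m ρ a : ℕ} {W : ℕ → ℕ → Set U} {alive : ℕ → Prop}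
    {s : MachineState U} (hs : RoundState D n m ρ W alive s) (h3 : s.vars 3 = a) (ha : a < m) :
    Reaches e D .treatTangle s (m * (n * 5 + 8) + n * 5 + 12) fun s' =>
      s'.vars 0 = s.vars 0 ∧ s'.vars 1 = s.vars 1 ∧ s'.vars 2 = s.vars 2 ∧ s'.vars 3 = a ∧
      s'.mem 0 = s.mem 0 ∧
      (alive a ∧ (∃ Z, IsCommonValue m W alive a Z) →
        s'.mem 1 = Function.update (s.mem 1) a (ρ + 1)) ∧
      (¬ (alive a ∧ ∃ Z, IsCommonValue m W alive a Z) → s'.mem 1 = s.mem 1) ∧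
      ∀ Y, Y ∈ s'.out ↔ Y ∈ s.out ∨
        alive a ∧ ∃ Z, IsCommonValue m W alive a Z ∧ (Y = Z ∨ Y = Zᶜ) := by
  have hdead := hs.dead_eval (a := .var 3) (show s.vars 3 < m by omega)
  have hev : (Expr.var 3).eval s = a := h3
  rw [hev] at hdead
  -- Common to the three ways of doing nothing: the tangle was dealt with earlier, no other tangle
  -- remains, or the separations differ.
  have hidle : ∀ s', Frame s s' → ¬ (alive a ∧ ∃ Z, IsCommonValue m W alive a Z) →
      s'.vars 0 = s.vars 0 ∧ s'.vars 1 = s.vars 1 ∧ s'.vars 2 = s.vars 2 ∧ s'.vars 3 = a ∧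
      s'.mem 0 = s.mem 0 ∧
      (alive a ∧ (∃ Z, IsCommonValue m W alive a Z) →
        s'.mem 1 = Function.update (s.mem 1) a (ρ + 1)) ∧
      (¬ (alive a ∧ ∃ Z, IsCommonValue m W alive a Z) → s'.mem 1 = s.mem 1) ∧
      ∀ Y, Y ∈ s'.out ↔ Y ∈ s.out ∨
        alive a ∧ ∃ Z, IsCommonValue m W alive a Z ∧ (Y = Z ∨ Y = Zᶜ) := by
    intro s' hf hno
    refine ⟨hf.vars_eq 0 (by omega), hf.vars_eq 1 (by omega), hf.vars_eq 2 (by omega),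
      (hf.vars_eq 3 (by omega)).trans h3, hf.mem_eq 0 (by omega), fun h => (hno h).elim,
      fun _ => hf.mem_eq 1 (by omega), fun Y => ?_⟩
    rw [hf.out_eq]
    refine ⟨Or.inl, fun h => h.resolve_right ?_⟩
    rintro ⟨hal, Z, hZ, -⟩
    exact hno ⟨hal, Z, hZ⟩
  refine (Reaches.ite (t := m * (n * 5 + 8) + n * 5 + 11) (fun hd => ?_) (fun hd => ?_)).mono
    le_rfl fun _ => id
  · exact (Reaches.skip (hidle s (Frame.refl s) fun h => hd (hdead.2 h.1))).mono (by omega)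
      fun _ => id
  have hal := hdead.1 hd
  have hf₀ : Frame s ((s.setVar 5 0).setVar 6 1) :=
    ((Frame.refl s).setVar (by omega) _).setVar (by omega) _
  refine (Reaches.seq (Reaches.assign (Reaches.seq (Reaches.assign (Reaches.seq
    ((reaches_scan (hs.of_frame hf₀) h3 ha rfl one_ne_zero).mono le_rfl
      (R := fun s' => Reaches e D _ s' (n * 5 + 7) _) ?_)))))).mono (by omega) fun _ => id
  rintro s₁ ⟨hf₁, hiff, hrow⟩
  have hf := hf₀.trans hf₁
  have hr := hs.of_frame hf
  refine (Reaches.ite (t := n * 5 + 6) (fun h5 => ?_) (fun h5 => ?_)).mono le_rfl fun _ => id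
  swap
  · refine (Reaches.skip (hidle s₁ hf fun h => ?_)).mono (by omega) fun _ => id
    exact (hiff.2 h.2).1 h5
  refine (Reaches.ite (t := n * 5 + 5) (fun h6 => ?_) (fun h6 => ?_)).mono le_rfl fun _ => id
  swap
  · refine (Reaches.skip (hidle s₁ hf fun h => ?_)).mono (by omega) fun _ => id
    exact (hiff.2 h.2).2 h6
  obtain ⟨Z, hZ⟩ := hiff.1 ⟨h5, h6⟩
  have hZu : ∀ Z', IsCommonValue m W alive a Z' → Z' = Z := fun Z' hZ' => by
    rw [← hrow Z hZ, ← hrow Z' hZ']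
  refine (Reaches.seq (t' := n * 3 + 2 + (n + 1 + 1)) (Reaches.emit (Reaches.seq
    ((reaches_complementRow (s := s₁.emitRow e 2) hr.vars_zero (hrow Z hZ)).mono le_rfl ?_)))).mono (by omega)
    fun _ => id
  rintro s₂ ⟨hf₂, hrow₂⟩
  refine Reaches.seq (Reaches.emit (Reaches.store ?_))
  have hv : ∀ x ≤ 3, s₂.vars x = s.vars x := fun x hx =>
    (hf₂.vars_eq x hx).trans (hf.vars_eq x hx)
  have hm : ∀ r ≤ 1, s₂.mem r = s.mem r := fun r hr =>
    (hf₂.mem_eq r hr).trans (hf.mem_eq r hr)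
  refine ⟨hv 0 (by omega), hv 1 (by omega), hv 2 (by omega), (hv 3 (by omega)).trans h3, ?_,
    fun _ => ?_, fun h => (h ⟨hal, Z, hZ⟩).elim, fun Y => ?_⟩
  · rw [← hm 0 (by omega)]
    simp [setCell, emitRow, Expr.eval]
  · simp [setCell, emitRow, Expr.eval, hm 1 le_rfl, hv 3 le_rfl, hv 2 (by omega), h3,
      hs.vars_two]
  · have hout : s₂.out = s.out ++ [Z] := by
      rw [hf₂.out_eq, ← hrow Z hZ, ← hf.out_eq]
      rfl
    have hout' : (s₂.emitRow e ((Expr.const 4).eval s₂)).out = s.out ++ [Z] ++ [Zᶜ] := by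
      rw [← hout, ← hrow₂]
      rfl
    show Y ∈ (s₂.emitRow e ((Expr.const 4).eval s₂)).out ↔ _
    rw [hout']
    simp only [List.append_assoc, List.mem_append, List.mem_singleton]
    refine or_congr_right ⟨fun h => ⟨hal, Z, hZ, h⟩, ?_⟩
    rintro ⟨-, Z', hZ', h⟩
    rwa [hZu Z' hZ'] at h

lemma reaches_round {m ρ : ℕ} {W : ℕ → ℕ → Set U} {alive : ℕ → Prop}
    {s : MachineState U} (hs : RoundState D n m ρ W alive s) :
    Reaches e D .round s (m * (m * (n * 5 + 8) + n * 5 + 14) + 2) fun s' =>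
      s'.vars 0 = n ∧ s'.vars 1 = m ∧ s'.vars 2 = ρ ∧ s'.mem 0 = s.mem 0 ∧
      (∀ a < m, (alive a ∧ ∃ Z, IsCommonValue m W alive a Z) → s'.mem 1 a = ρ + 1) ∧
      (∀ a < m, (¬ (alive a ∧ ∃ Z, IsCommonValue m W alive a Z)) → s'.mem 1 a = s.mem 1 a) ∧
      ∀ Y, Y ∈ s'.out ↔ Y ∈ s.out ∨
        ∃ a < m, alive a ∧ ∃ Z, IsCommonValue m W alive a Z ∧ (Y = Z ∨ Y = Zᶜ) := by
  refine (Reaches.forDown (t := m * (n * 5 + 8) + n * 5 + 12) (N := m) (fun i s' =>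
      s'.vars 3 = i ∧ s'.vars 0 = n ∧ s'.vars 1 = m ∧ s'.vars 2 = ρ ∧ s'.mem 0 = s.mem 0 ∧
      (∀ a < m, i ≤ a → (alive a ∧ ∃ Z, IsCommonValue m W alive a Z) → s'.mem 1 a = ρ + 1) ∧
      (∀ a < m, ¬ (i ≤ a ∧ alive a ∧ ∃ Z, IsCommonValue m W alive a Z) →
        s'.mem 1 a = s.mem 1 a) ∧
      ∀ Y, Y ∈ s'.out ↔ Y ∈ s.out ∨
        ∃ a < m, i ≤ a ∧ alive a ∧ ∃ Z, IsCommonValue m W alive a Z ∧ (Y = Z ∨ Y = Zᶜ))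
    (fun i s h => h.1) (show (Expr.var 1).eval s = m from hs.vars_one) ?_ ?_).mono le_rfl ?_
  · refine ⟨rfl, hs.vars_zero, hs.vars_one, hs.vars_two, rfl, fun a h₁ h₂ => by omega,
      fun _ _ _ => rfl, fun Y => ⟨Or.inl, fun h => h.resolve_right ?_⟩⟩
    rintro ⟨a, h₁, h₂, -⟩
    omega
  · rintro i hi s' ⟨-, h0, h1, h2, hm0, hact, hidle, hout⟩
    have hr : RoundState D n m ρ W alive (s'.setVar 3 i) := by
      refine ⟨h0, h1, h2, ?_, fun a ha => ?_⟩
      · show ∀ a < m, ∀ b < m, a ≠ b → D.sep (s'.mem 0 a) (s'.mem 0 b) = _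
        rw [hm0]
        exact hs.sep_eq
      · show s'.mem 1 a ≤ ρ + 1 ↔ _
        by_cases h : i + 1 ≤ a ∧ alive a ∧ ∃ Z, IsCommonValue m W alive a Z
        · rw [hact a ha h.1 h.2]
          exact iff_of_true le_rfl h.2.1
        · rw [hidle a ha h]
          exact hs.le_iff a ha
    refine (reaches_treatTangle (a := i) hr rfl hi).mono le_rfl ?_
    rintro s₁ ⟨g0, g1, g2, g3, gm0, gact, gidle, gout⟩
    refine ⟨g3, g0.trans h0, g1.trans h1, g2.trans h2, gm0.trans hm0, fun a ha hia h => ?_,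
      fun a ha h => ?_, fun Y => ?_⟩
    · by_cases hc : alive i ∧ ∃ Z, IsCommonValue m W alive i Z
      · rw [gact hc]
        rcases hia.eq_or_lt with rfl | hia
        · simp
        · rw [Function.update_of_ne (by omega)]
          exact hact a ha hia h
      · rw [gidle hc]
        rcases hia.eq_or_lt with rfl | hia
        · exact (hc h).elim
        · exact hact a ha hia h
    · have ha' : s'.mem 1 a = s.mem 1 a := hidle a ha fun h' => h ⟨by omega, h'.2⟩
      by_cases hc : alive i ∧ ∃ Z, IsCommonValue m W alive i Z
      · rw [gact hc, Function.update_of_ne]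
        · exact ha'
        · rintro rfl
          exact h ⟨le_rfl, hc⟩
      · rw [gidle hc]
        exact ha'
    · rw [gout, show (s'.setVar 3 i).out = s'.out from rfl, hout, or_assoc]
      refine or_congr_right ⟨?_, ?_⟩
      · rintro (⟨a, ha, hia, h⟩ | h)
        · exact ⟨a, ha, by omega, h⟩
        · exact ⟨i, hi, le_rfl, h⟩
      · rintro ⟨a, ha, hia, h⟩
        rcases hia.eq_or_lt with rfl | hia
        · exact Or.inr h
        · exact Or.inl ⟨a, ha, hia, h⟩
  · rintro s' ⟨-, h0, h1, h2, hm0, hact, hidle, hout⟩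
    exact ⟨h0, h1, h2, hm0, fun a ha h => hact a ha (Nat.zero_le _) h,
      fun a ha h => hidle a ha fun h' => h h'.2, by simpa using hout⟩

end Programs

/-! ### Correctness of the program -/

section Correctness

namespace TangleProcedures

variable {U : Type*} {D : TangleProcedures U} {κ : ConnectivityFunction U}

lemma Represents.unique {i : ℕ} {T T' : Tangle κ} (h : D.Represents i T)
    (h' : D.Represents i T') : T = T' :=
  Tangle.ext (h.1.symm.trans h'.1) (Set.ext fun X => (h.2 X).symm.trans (h'.2 X))

lemma IsComprehensive.order_le (hD : D.IsComprehensive κ) {i : ℕ} {T : Tangle κ}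
    (hi : D.IsIndex κ i) (h : D.Represents i T) : T.order ≤ D.order := by
  obtain ⟨T', hT', h'⟩ := hD.exists_tangle i hi
  rwa [h.unique h']

/-- Although programs cannot call `find`, its specification makes the index of a tangle unique, so
different list positions stand for different tangles. -/
lemma IsComprehensive.eq_find (hD : D.IsComprehensive κ) {i : ℕ} {T : Tangle κ}
    (hi : D.IsIndex κ i) (h : D.Represents i T) : i = D.find T.order T.sets :=
  (hD.find_spec T (hD.order_le hi h)).2.2 i hi h

end TangleProcedures

namespace CoherentInput

variable {k : ℕ} {U : Type*} (I : CoherentInput k U)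

lemma finite_ground {k : ℕ} {U : Type*} (I : CoherentInput k U) : Finite U := Finite.of_equiv _ I.enum

lemma card_ground : Nat.card U = I.n := by
  rw [← Nat.card_congr I.enum, Nat.card_fin]

/-- The entry of the list of indices at position `a`. -/
def index (a : ℕ) : ℕ := I.indices.getD a 0

lemma index_mem {a : ℕ} (ha : a < I.indices.length) : I.index a ∈ I.indices := by
  rw [index, List.getD_eq_getElem _ _ ha]
  exact List.getElem_mem ha

lemma index_injOn {a b : ℕ} (ha : a < I.indices.length) (hb : b < I.indices.length)
    (h : I.index a = I.index b) : a = b := by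
  rw [index, index, List.getD_eq_getElem _ _ ha, List.getD_eq_getElem _ _ hb] at h
  exact (I.nodup.getElem_inj_iff).1 h

lemma exists_represents {a : ℕ} (ha : a < I.indices.length) :
    ∃ T ∈ I.family, I.D.Represents (I.index a) T :=
  (I.index_spec _ (I.index_mem ha)).2

lemma exists_index {T : Tangle I.κ} (hT : T ∈ I.family) :
    ∃ a < I.indices.length, I.D.Represents (I.index a) T := by
  obtain ⟨i, hi, h⟩ := I.index_complete T hT
  obtain ⟨a, ha, rfl⟩ := List.getElem_of_mem hi
  refine ⟨a, ha, ?_⟩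
  rwa [index, List.getD_eq_getElem _ _ ha]

lemma position_unique {a b : ℕ} {T : Tangle I.κ} (ha : a < I.indices.length)
    (hb : b < I.indices.length) (h : I.D.Represents (I.index a) T)
    (h' : I.D.Represents (I.index b) T) : a = b :=
  I.index_injOn ha hb <|
    (I.comprehensive.eq_find (I.index_spec _ (I.index_mem ha)).1 h).trans
      (I.comprehensive.eq_find (I.index_spec _ (I.index_mem hb)).1 h').symm

lemma finite_family_and_ncard : I.family.Finite ∧ I.family.ncard = I.indices.length := by
  have hfind : ∀ T ∈ I.family, ∀ i ∈ I.indices, I.D.Represents i T →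
      i = I.D.find T.order T.sets := fun T _ i hi h =>
    I.comprehensive.eq_find (I.index_spec i hi).1 h
  have himage : (fun T : Tangle I.κ => I.D.find T.order T.sets) '' I.family =
      I.indices.toFinset := by
    ext i
    simp only [Set.mem_image, List.coe_toFinset, Set.mem_ofPred_eq]
    constructor
    · rintro ⟨T, hT, rfl⟩
      obtain ⟨i, hi, h⟩ := I.index_complete T hT
      rwa [← hfind T hT i hi h]
    · intro hi
      obtain ⟨-, T, hT, h⟩ := I.index_spec i hi
      exact ⟨T, hT, (hfind T hT i hi h).symm⟩
  have hinj : Set.InjOn (fun T : Tangle I.κ => I.D.find T.order T.sets) I.family := by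
    intro T hT T' hT' heq
    obtain ⟨i, hi, h⟩ := I.index_complete T hT
    obtain ⟨j, hj, h'⟩ := I.index_complete T' hT'
    have hij : i = j := (hfind T hT i hi h).trans (heq.trans (hfind T' hT' j hj h').symm)
    subst hij
    exact h.unique h'
  refine ⟨Set.Finite.of_finite_image (himage ▸ Finset.finite_toSet _) hinj, ?_⟩
  rw [← hinj.ncard_image, himage, Set.ncard_coe_finset,
    List.toFinset_card_of_nodup I.nodup]

lemma length_le : I.indices.length ≤ I.n ^ 2 + 1 := by
  have := I.finite_ground
  rw [← I.finite_family_and_ncard.2, ← I.card_ground]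
  exact I.coherent.ncard_le I.finite_family_and_ncard.1

/-- The leftmost minimum separation of the tangles at the positions `a` and `b`. -/
def sepAt (a b : ℕ) : Set U := (I.D.sep (I.index a) (I.index b)).getD ∅

lemma sep_iff {a b : ℕ} (ha : a < I.indices.length) (hb : b < I.indices.length) (hab : a ≠ b)
    {S T : Tangle I.κ} (hS : I.D.Represents (I.index a) S) (hT : I.D.Represents (I.index b) T)
    (Z : Set U) :
    I.D.sep (I.index a) (I.index b) = some Z ↔ S.IsLeftmostMinSeparation T Z :=
  I.comprehensive.sep_spec _ _ S T (I.index_spec _ (I.index_mem ha)).1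
    (I.index_spec _ (I.index_mem hb)).1 (fun h => hab (I.index_injOn ha hb h)) hS hT Z

/-- Distinct positions carry distinct tangles of a coherent family, which have a leftmost
separation; the default `∅` in `sepAt` is thus never met off the diagonal. -/
lemma sep_eq {a b : ℕ} (ha : a < I.indices.length) (hb : b < I.indices.length) (hab : a ≠ b) :
    I.D.sep (I.index a) (I.index b) = some (I.sepAt a b) := by
  have := I.finite_ground
  obtain ⟨S, hS, hS'⟩ := I.exists_represents ha
  obtain ⟨T, hT, hT'⟩ := I.exists_represents hb
  obtain ⟨Z, hZ⟩ := I.coherent.exists_isLeftmost hS hT fun h =>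
    hab (I.position_unique ha hb hS' (h ▸ hT'))
  have := (I.sep_iff ha hb hab hS' hT' Z).2 hZ
  rw [sepAt, this, Option.getD_some]

/-- The tangle at position `a` belongs to `G`. -/
def Alive (G : Set (Tangle I.κ)) (a : ℕ) : Prop := ∃ T ∈ G, I.D.Represents (I.index a) T

/-- The bridge between the combinatorial test of the program and the isolation of tangles. -/
lemma isCommonValue_iff {G : Set (Tangle I.κ)} (hG : G ⊆ I.family) {a : ℕ}
    (ha : a < I.indices.length) {S : Tangle I.κ} (hSG : S ∈ G)
    (hS : I.D.Represents (I.index a) S) (Z : Set U) :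
    IsCommonValue I.indices.length I.sepAt (I.Alive G) a Z ↔ IsolatesIn G S Z := by
  constructor
  · rintro ⟨⟨b, hb, ⟨T, hTG, hT⟩, hba⟩, hall⟩
    refine ⟨hSG, ⟨T, hTG, ?_⟩, fun T' hT' hne => ?_⟩
    · rintro rfl
      exact hba (I.position_unique hb ha hT hS)
    · obtain ⟨c, hc, hcT⟩ := I.exists_index (hG hT')
      have hca : c ≠ a := by
        rintro rfl
        exact hne (hcT.unique hS)
      rw [← I.sep_iff ha hc hca.symm hS hcT, I.sep_eq ha hc hca.symm,
        hall c hc ⟨T', hT', hcT⟩ hca]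
  · rintro ⟨-, ⟨T, hTG, hne⟩, hall⟩
    obtain ⟨b, hb, hT⟩ := I.exists_index (hG hTG)
    refine ⟨⟨b, hb, ⟨T, hTG, hT⟩, ?_⟩, ?_⟩
    · rintro rfl
      exact hne (hT.unique hS)
    · rintro c hc ⟨T', hT'G, hT'⟩ hca
      have h := hall T' hT'G fun h => hca (I.position_unique hc ha (h ▸ hT') hS)
      rw [← I.sep_iff ha hc hca.symm hS hT', I.sep_eq ha hc hca.symm] at h
      exact Option.some_injective _ h

/-- The state between two rounds, when `i` rounds remain and `r` rounds are over. -/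
structure LayerState (i r : ℕ) (s : MachineState U) : Prop where
  vars_two : s.vars 2 = i
  vars_zero : s.vars 0 = I.n
  vars_one : s.vars 1 = I.indices.length
  mem_zero : ∀ a, s.mem 0 a = I.index a
  lt_of_mem : ∀ a < I.indices.length, ∀ T ∈ I.family, I.D.Represents (I.index a) T →
    T ∈ (layer I.family r).2 → i < s.mem 1 a
  eq_zero_of_notMem : ∀ a < I.indices.length, ∀ T ∈ I.family, I.D.Represents (I.index a) T →
    T ∉ (layer I.family r).2 → s.mem 1 a = 0
  mem_out : ∀ Y, Y ∈ s.out ↔ Y ∈ (layer I.family r).1 ∨ Yᶜ ∈ (layer I.family r).1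

lemma reaches_round_of_layerState {i r : ℕ} {s : MachineState U}
    (h : I.LayerState (i + 1) r s) :
    Reaches I.enum I.D .round (s.setVar 2 i)
      (I.indices.length * (I.indices.length * (I.n * 5 + 8) + I.n * 5 + 14) + 2)
      (I.LayerState i (r + 1)) := by
  have := I.finite_ground
  set G := I.family \ (layer I.family r).2 with hGdef
  have hG : G ⊆ I.family := Set.sdiff_subset
  have hr : RoundState I.D I.n I.indices.length i I.sepAt (I.Alive G) (s.setVar 2 i) := by
    refine ⟨h.vars_zero, h.vars_one, rfl, fun a ha b hb hab => ?_, fun a ha => ?_⟩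
    · show I.D.sep (s.mem 0 a) (s.mem 0 b) = _
      rw [h.mem_zero, h.mem_zero, I.sep_eq ha hb hab]
    · show s.mem 1 a ≤ i + 1 ↔ _
      obtain ⟨T, hT, hTa⟩ := I.exists_represents ha
      by_cases hTl : T ∈ (layer I.family r).2
      · refine iff_of_false (not_le.2 (h.lt_of_mem a ha T hT hTa hTl)) ?_
        rintro ⟨T', hT', hTa'⟩
        rw [hTa.unique hTa'] at hTl
        exact hT'.2 hTl
      · rw [h.eq_zero_of_notMem a ha T hT hTa hTl]
        exact iff_of_true (Nat.zero_le _) ⟨T, ⟨hT, hTl⟩, hTa⟩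
  have hact : ∀ a < I.indices.length, ∀ T ∈ I.family, I.D.Represents (I.index a) T →
      (I.Alive G a ∧ (∃ Z, IsCommonValue I.indices.length I.sepAt (I.Alive G) a Z) ↔
        ∃ Z, IsolatesIn G T Z) := by
    intro a ha T hT hTa
    constructor
    · rintro ⟨⟨T', hT', hTa'⟩, Z, hZ⟩
      obtain rfl := hTa.unique hTa'
      exact ⟨Z, (I.isCommonValue_iff hG ha hT' hTa Z).1 hZ⟩
    · rintro ⟨Z, hZ⟩
      exact ⟨⟨T, hZ.1, hTa⟩, Z, (I.isCommonValue_iff hG ha hZ.1 hTa Z).2 hZ⟩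
  refine (reaches_round hr).mono le_rfl ?_
  rintro s' ⟨h0, h1, h2, hm0, hstamp, hidle, hout⟩
  refine ⟨h2, h0, h1, fun a => ?_, fun a ha T hT hTa hTl => ?_, fun a ha T hT hTa hTl => ?_,
    fun Y => ?_⟩
  · rw [hm0]
    exact h.mem_zero a
  -- A tangle isolated in this round has stamp `i + 1`; one dealt with before keeps a stamp above `i
  -- + 1`.
  · by_cases hc : ∃ Z, IsolatesIn G T Z
    · rw [hstamp a ha ((hact a ha T hT hTa).2 hc)]
      exact Nat.lt_succ_self i
    · rw [hidle a ha (mt (hact a ha T hT hTa).1 hc)]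
      have := h.lt_of_mem a ha T hT hTa
        ((I.coherent.mem_layer_succ_snd.1 hTl).resolve_right hc)
      exact (Nat.lt_succ_self i).trans this
  · rw [I.coherent.mem_layer_succ_snd, not_or] at hTl
    rw [hidle a ha (mt (hact a ha T hT hTa).1 hTl.2)]
    exact h.eq_zero_of_notMem a ha T hT hTa hTl.1
  · have hex : ∀ p : Set U → Prop, (∃ a < I.indices.length, I.Alive G a ∧
        ∃ Z, IsCommonValue I.indices.length I.sepAt (I.Alive G) a Z ∧ p Z) ↔
        ∃ Z, (∃ S, IsolatesIn G S Z) ∧ p Z := by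
      intro p
      constructor
      · rintro ⟨a, ha, ⟨T, hT, hTa⟩, Z, hZ, hp⟩
        exact ⟨Z, ⟨T, (I.isCommonValue_iff hG ha hT hTa Z).1 hZ⟩, hp⟩
      · rintro ⟨Z, ⟨T, hT⟩, hp⟩
        obtain ⟨a, ha, hTa⟩ := I.exists_index (hG hT.1)
        exact ⟨a, ha, ⟨T, hT.1, hTa⟩, Z, (I.isCommonValue_iff hG ha hT.1 hTa Z).2 hT, hp⟩
    rw [hout, hex, I.coherent.mem_layer_succ_fst, I.coherent.mem_layer_succ_fst,
      show (s.setVar 2 i).out = s.out from rfl, h.mem_out]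
    have hor : (∃ Z, (∃ S, IsolatesIn G S Z) ∧ (Y = Z ∨ Y = Zᶜ)) ↔
        (∃ S, IsolatesIn G S Y) ∨ ∃ S, IsolatesIn G S Yᶜ := by
      constructor
      · rintro ⟨Z, hZ, rfl | rfl⟩
        · exact Or.inl hZ
        · exact Or.inr (by rwa [compl_compl])
      · rintro (h | h)
        · exact ⟨Y, h, Or.inl rfl⟩
        · exact ⟨Yᶜ, h, Or.inr (compl_compl Y).symm⟩
    rw [hor]
    tauto

lemma reaches_layers : Reaches I.enum I.D .layers (MachineState.init U I.n I.indices)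
    (I.indices.length *
      (I.indices.length * (I.indices.length * (I.n * 5 + 8) + I.n * 5 + 14) + 2 + 2) + 2)
    fun s => layeredFamily I.family = {Z | Z ∈ s.out} := by
  have := I.finite_ground
  refine (Reaches.forDown
    (t := I.indices.length * (I.indices.length * (I.n * 5 + 8) + I.n * 5 + 14) + 2)
    (N := I.indices.length)
    (fun i s => I.LayerState i (I.indices.length - i) s) (fun i s h => h.vars_two)
    (show (Expr.var 1).eval (MachineState.init U I.n I.indices) = _ from rfl) ?_ ?_).mono le_rfl ?_
  · rw [Nat.sub_self]
    refine ⟨rfl, rfl, rfl, fun a => rfl, fun a ha T hT hTa h => h.elim,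
      fun a ha T hT hTa h => rfl, fun Y => ?_⟩
    simp [MachineState.setVar, MachineState.init, layer]
  · intro i hi s h
    have := I.reaches_round_of_layerState h
    rwa [show I.indices.length - (i + 1) + 1 = I.indices.length - i by omega] at this
  · intro s h
    ext Z
    rw [I.coherent.mem_layeredFamily_iff I.finite_family_and_ncard.1, I.finite_family_and_ncard.2]
    exact (h.mem_out Z).symm

end CoherentInput

end Correctness

/-! ### The main theorem. -/

theorem lemma4 (k : ℕ) :
    ∃ (p : Prog) (q : Polynomial ℕ),
      -- on every input, `p` computes in polynomial time a nested family, built layer by layer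
      (∀ (U : Type u) (I : CoherentInput k U), ∃ (t : ℕ) (N : Set (Set U)),
        p.Computes I t N ∧ t ≤ q.eval (Nat.card U) ∧
        IsNestedFamilyFor N I.family ∧ N = layeredFamily I.family) ∧
      -- the output is canonical
      (∀ (U₁ U₂ : Type u) (I₁ : CoherentInput k U₁) (I₂ : CoherentInput k U₂)
        (f : I₁.κ.Iso I₂.κ), I₂.family = Tangle.map f '' I₁.family →
        ∀ (t₁ t₂ : ℕ) (N₁ : Set (Set U₁)) (N₂ : Set (Set U₂)),
          p.Computes I₁ t₁ N₁ → p.Computes I₂ t₂ N₂ →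
          N₂ = (fun X => f.toEquiv '' X) '' N₁) := by
  have computes_eq : ∀ {U : Type u} (I : CoherentInput k U) (t : ℕ) (N : Set (Set U)),
      Prog.layers.Computes I t N → N = layeredFamily I.family := by
    rintro U I t N ⟨s, hs, rfl⟩
    obtain ⟨t', s', hs', -, h⟩ := I.reaches_layers
    rw [h, hs.eq_of_runs hs']
  -- The polynomial is the bound of `reaches_layers` with the number of tangles replaced by its
  -- bound `|U|² + 1`.
  refine ⟨.layers, (.X ^ 2 + 1) * ((.X ^ 2 + 1) * ((.X ^ 2 + 1) * (.X * 5 + 8) + .X * 5 + 14)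
    + 2 + 2) + 2, fun U I => ?_, ?_⟩
  · have := I.finite_ground
    obtain ⟨t, s, hs, ht, h⟩ := I.reaches_layers
    refine ⟨t, layeredFamily I.family, ⟨s, hs, h⟩, ht.trans ?_,
      I.coherent.isNestedFamilyFor I.finite_family_and_ncard.1, rfl⟩
    have hlen := I.length_le
    simp only [I.card_ground, Polynomial.eval_add, Polynomial.eval_mul, Polynomial.eval_pow,
      Polynomial.eval_X, Polynomial.eval_one, Polynomial.eval_ofNat]
    gcongr
  · intro U₁ U₂ I₁ I₂ f hf t₁ t₂ N₁ N₂ h₁ h₂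
    rw [computes_eq I₁ t₁ N₁ h₁, computes_eq I₂ t₂ N₂ h₂, hf, layeredFamily_map]
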